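/- Let $F_2$ be the free group on $X,Y$ and put $Z=(XY)^{-1}$. Let $\Omega$ be the set of equivalence classes of primitive elements of $F_2$ (elements that belong to a free basis), where $g\sim h$ if $g$ is conjugate to $h$ or to $h^{-1}$. Identify the character variety of representations $\rho:F_2\to \mathrm{SL}(2,\mathbb C)$ with $\mathbb C^3$ through $\rho\mapsto(\operatorname{tr}\rho(X),\operatorname{tr}\rho(Y),\operatorname{tr}\rho(Z))$, and let $\mu_\rho:\Omega\to\mathbb C$, $\mu_\rho([g])=\operatorname{tr}\rho(g)$. The Bowditch set $\mathfrak B\subset\mathbb C^3$ is the set of characters of representations $\rho$ that are irreducible (no invariant line in $\mathbb C^2$) and satisfy (i) $\mu_\rho(\omega)\notin[-2,2]$ for all $\omega\in\Omega$, and (ii) the set $\{\omega\in\Omega : |\mu_\rho(\omega)|\le 2\}$ is finite. For $(x,y,z)\in\mathbb R^3$ let $\kappa_\Phi(x,y,z)=-x^2-y^2+z^2+xyz-2$, which is the trace of $\rho(XYX^{-1}Y^{-1})$ for a representation $\rho$ with the purely imaginary character $(ix,iy,z)$. **Theorem.** Let $k>2$ be real. Then the set $$\{(x,y,z)\in\kappa_\Phi^{-1}(k)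 : (ix,iy,z)\notin\mathfrak B\}$$ has empty interior in the level surface $\kappa_\Phi^{-1}(k)\subset\mathbb R^3$ (with the topology induced from $\mathbb R^3$). -/

import Mathlib

noncomputable section

namespace ImaginaryCharacters

/-- The free group of rank two. -/
abbrev F2 : Type := FreeGroup (Fin 2)

/-- The group `SL(2, ℂ)`. -/
abbrev SL2C : Type := Matrix.SpecialLinearGroup (Fin 2) ℂ

/-- The first element `X` of the fixed basis of `F2`. -/
def genX : F2 := FreeGroup.of 0

/-- The second element `Y` of the fixed basis of `F2`. -/
def genY : F2 := FreeGroup.of 1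

/-- The third element `Z` of the basic triple `(X, Y, Z)`, so that `X * Y * Z = 1`. -/
def genZ : F2 := (genX * genY)⁻¹

/-- An element of `F2` is primitive if it lies in a free basis of `F2`. -/
def IsPrimitive (g : F2) : Prop :=
  ∃ (b : FreeGroupBasis (Fin 2) F2) (i : Fin 2), b i = g

/-- The set of primitive elements of `F2`, as a type. -/
abbrev Prim : Type := {g : F2 // IsPrimitive g}

/-- Two primitive elements are equivalent if the first one is conjugate to the second one or to
its inverse. -/
def primSetoid : Setoid Prim where
  r g h := IsConj g.1 h.1 ∨ IsConj g.1 h.1⁻¹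
  iseqv :=
    { refl := fun g => Or.inl (IsConj.refl g.1)
      symm := by
        rintro g h (e | e)
        · exact Or.inl e.symm
        · right
          obtain ⟨c, hc⟩ := isConj_iff.1 e
          exact (isConj_iff.2 ⟨c, by rw [← inv_inj, ← hc]; group⟩ : IsConj g.1⁻¹ h.1).symm
      trans := by
        have inv : ∀ a b : F2, IsConj a b → IsConj a⁻¹ b⁻¹ := by
          intro a b e
          obtain ⟨c, hc⟩ := isConj_iff.1 e
          exact isConj_iff.2 ⟨c, by rw [← hc]; group⟩
        rintro g h l (e | e) (f | f)
        · exact Or.inl (e.trans f)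
        · exact Or.inr (e.trans f)
        · exact Or.inr (e.trans (inv _ _ f))
        · left
          have f' := inv _ _ f
          rw [inv_inv] at f'
          exact e.trans f' }

/-- The set `Ω` of equivalence classes of primitive elements (equivalently, the complementary
regions of the planar trivalent tree of superbases, or the rational points of the projective
line). -/
def Region : Type := Quotient primSetoid

/-- The trace of the image of a group element. -/
def tr (ρ : F2 →* SL2C) (g : F2) : ℂ := Matrix.trace (ρ g : Matrix (Fin 2) (Fin 2) ℂ)

theorem tr_inv (ρ : F2 →* SL2C) (g : F2) : tr ρ g⁻¹ = tr ρ g := by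
  simp [tr, Matrix.trace, Matrix.SpecialLinearGroup.coe_inv, Matrix.adjugate_fin_two, add_comm]

theorem tr_conj (ρ : F2 →* SL2C) {g h : F2} (e : IsConj g h) : tr ρ g = tr ρ h := by
  obtain ⟨c, hc⟩ := isConj_iff.1 e
  have key : ((ρ c)⁻¹ * (ρ c * ρ g) : SL2C) = ρ g := by group
  rw [← hc]
  unfold tr
  rw [map_mul, map_mul, map_inv, Matrix.SpecialLinearGroup.coe_mul, Matrix.trace_mul_comm,
    ← Matrix.SpecialLinearGroup.coe_mul, key]

/-- The trace labeling `μ : Ω → ℂ` of a representation: the class of `g` is sent to the trace of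
`ρ g`. -/
def traceLabeling (ρ : F2 →* SL2C) : Region → ℂ :=
  Quotient.lift (fun g : Prim => tr ρ g.1) (by
    rintro g h (e | e)
    · exact tr_conj ρ e
    · exact (tr_conj ρ e).trans (tr_inv ρ h.1))

/-- The character of a representation, in the coordinates
`(ξ, η, ζ) = (tr ρ(X), tr ρ(Y), tr ρ(Z))` that identify the character variety with `ℂ³`. -/
def character (ρ : F2 →* SL2C) : ℂ × ℂ × ℂ := (tr ρ genX, tr ρ genY, tr ρ genZ)

/-- A representation is irreducible if no line in `ℂ²` is invariant. -/
def IsIrreducible (ρ : F2 →* SL2C) : Prop :=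
  ¬ ∃ v : Fin 2 → ℂ, v ≠ 0 ∧
    ∀ g : F2, ∃ c : ℂ, (ρ g : Matrix (Fin 2) (Fin 2) ℂ).mulVec v = c • v

/-- The Bowditch conditions on a representation: it is irreducible, its trace labeling takes no
value in the real interval `[-2, 2]`, and only finitely many classes of primitive elements have a
trace of absolute value at most `2`. -/
structure IsBowditch (ρ : F2 →* SL2C) : Prop where
  irreducible : IsIrreducible ρ
  notMem_Icc : ∀ ω : Region, traceLabeling ρ ω ∉ (fun t : ℝ => (t : ℂ)) '' Set.Icc (-2) 2
  finite_small : {ω : Region | ‖traceLabeling ρ ω‖ ≤ 2}.Finite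

/-- The Bowditch set in the character variety `ℂ³`. -/
def bowditchSet : Set (ℂ × ℂ × ℂ) := {χ | ∃ ρ : F2 →* SL2C, character ρ = χ ∧ IsBowditch ρ}

/-- The trace of the commutator of `X` and `Y`, as a function on `ℂ³`. -/
def kappa (χ : ℂ × ℂ × ℂ) : ℂ :=
  χ.1 ^ 2 + χ.2.1 ^ 2 + χ.2.2 ^ 2 - χ.1 * χ.2.1 * χ.2.2 - 2

/-- The purely imaginary real form: `(x, y, z)` is sent to `(i x, i y, z)`. -/
def imaginaryCharacter (p : ℝ × ℝ × ℝ) : ℂ × ℂ × ℂ :=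
  (Complex.I * (p.1 : ℂ), Complex.I * (p.2.1 : ℂ), (p.2.2 : ℂ))

/-- The commutator trace on purely imaginary characters. -/
def kappaImaginary (p : ℝ × ℝ × ℝ) : ℝ :=
  -p.1 ^ 2 - p.2.1 ^ 2 + p.2.2 ^ 2 + p.1 * p.2.1 * p.2.2 - 2

theorem kappa_imaginaryCharacter (p : ℝ × ℝ × ℝ) :
    kappa (imaginaryCharacter p) = (kappaImaginary p : ℂ) := by
  simp only [kappa, imaginaryCharacter, kappaImaginary]
  push_cast
  linear_combination
    ((p.1 : ℂ) ^ 2 + (p.2.1 : ℂ) ^ 2 - (p.1 : ℂ) * p.2.1 * p.2.2) * Complex.I_sq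

/-- The level surface of the commutator trace in the space of purely imaginary characters. It
carries the topology induced from `ℝ³`. -/
def levelSurface (k : ℝ) : Set (ℝ × ℝ × ℝ) := {p | kappaImaginary p = k}

end ImaginaryCharacters

end

/-!
Fix `k > 2`. A basis `(a, b)` of the free group with the traces `(i x, i y, z)` has three neighbours
in the tree of superbases, obtained by the moves `x ↦ y z - x`, `y ↦ x z - y`, `z ↦ -(x y + z)`. On
the level surface `|z| > 2` (`two_lt_posRoot`), which has two consequences.

* At a basis with `x y z ≠ 0` at most one of the three moves fails to increase the absolute value of
  its trace. If some basis is a *sink*, where no move decreases, then the traces grow by a definite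
  amount with each further step (`IsImagTriple.step`, `SternBrocot.growth`), so that only finitely
  many products at nodes of the tree have traces of absolute value at most `2`. Since all primitive
  classes occur in the tree, by Nielsen's theorem in rank two (`nielsenEquiv_gen`,
  `NielsenEquiv.sternBrocotPair`), such a representation is in the Bowditch set
  (`isBowditch_of_sink`).
* If no basis is a sink and no trace vanishes, then the moves descend forever and `(x, y)` tends to
  `(0, 0)` (`tendsto_zero_of_descent`).

It remains to find points with a sink in every nonempty open subset of the surface. Each of its two
sheets is a graph over the `(x, y)` plane, on which the moves act by involutions. Near a point where
some imaginary trace vanishes, the moves around its region are slow rotations, and for suitable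
angles they hit a sink (`exists_hasSink_of_mul_eq_zero`). If neither a sink nor a vanishing trace
occurs in the orbits of a connected open set, then the descending move is the same at all its
points, by continuity, and the descent carries the whole set along one sequence of moves towards the
origin (`exists_descent`). But the moves preserve the area `dx dy / (∂κ/∂z)` of the surface
(`measurePreserving_move`), of which neighbourhoods of the origin contain arbitrarily little: a
contradiction (`exists_hasSink`).
-/

namespace ImaginaryCharacters

/-! ### Cancellation in free groups -/

section Cancellation

/-- The longest common prefix of two lists. -/
def commonPrefix {β : Type*} [DecidableEq β] : List β → List β → List β
  | a :: l, b :: m => if a = b then a :: commonPrefix l m else []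
  | _, _ => []

variable {β : Type*} [DecidableEq β]

theorem exists_eq_commonPrefix_append (l m : List β) :
    ∃ A B, l = commonPrefix l m ++ A ∧ m = commonPrefix l m ++ B ∧
      ∀ a ∈ A.head?, ∀ b ∈ B.head?, a ≠ b := by
  induction l generalizing m with
  | nil => exact ⟨[], m, by simp [commonPrefix], by simp [commonPrefix], by simp⟩
  | cons a l ih =>
    cases m with
    | nil => exact ⟨a :: l, [], by simp [commonPrefix], by simp [commonPrefix], by simp⟩
    | cons b m =>
      by_cases h : a = b
      · obtain ⟨A, B, hA, hB, hne⟩ := ih m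
        refine ⟨A, B, ?_, ?_, hne⟩
        · simpa [commonPrefix, h] using hA
        · simpa [commonPrefix, h] using hB
      · exact ⟨a :: l, b :: m, by simp [commonPrefix, h], by simp [commonPrefix, h], by simpa⟩

theorem commonPrefix_prefix_left (l m : List β) : commonPrefix l m <+: l := by
  obtain ⟨A, B, hA, -, -⟩ := exists_eq_commonPrefix_append l m
  exact ⟨A, hA.symm⟩

theorem commonPrefix_prefix_right (l m : List β) : commonPrefix l m <+: m := by
  obtain ⟨A, B, -, hB, -⟩ := exists_eq_commonPrefix_append l m
  exact ⟨B, hB.symm⟩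

theorem prefix_commonPrefix {p l m : List β} (hl : p <+: l) (hm : p <+: m) :
    p <+: commonPrefix l m := by
  induction p generalizing l m with
  | nil => exact List.nil_prefix
  | cons a p ih =>
    obtain ⟨l', rfl⟩ := hl
    obtain ⟨m', rfl⟩ := hm
    simp only [List.cons_append, commonPrefix, if_true, List.prefix_cons_inj]
    exact ih (List.prefix_append _ _) (List.prefix_append _ _)

theorem length_commonPrefix_comm (l m : List β) :
    (commonPrefix l m).length = (commonPrefix m l).length :=
  le_antisymm
    (prefix_commonPrefix (commonPrefix_prefix_right l m) (commonPrefix_prefix_left l m)).length_le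
    (prefix_commonPrefix (commonPrefix_prefix_right m l) (commonPrefix_prefix_left m l)).length_le

variable {α : Type*} [DecidableEq α]

/-- The Gromov product of two elements of a free group: the length of the longest common prefix
of their reduced words. -/
def gromov (g h : FreeGroup α) : ℕ := (commonPrefix g.toWord h.toWord).length

theorem gromov_comm (g h : FreeGroup α) : gromov g h = gromov h g :=
  length_commonPrefix_comm _ _

/-- The Gromov product is an ultrametric: a free group is `0`-hyperbolic. -/
theorem min_gromov_le (g h k : FreeGroup α) : min (gromov g h) (gromov h k) ≤ gromov g k := by
  have h1 := commonPrefix_prefix_right g.toWord h.toWord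
  have h2 := commonPrefix_prefix_left h.toWord k.toWord
  rcases le_total (gromov g h) (gromov h k) with hle | hle
  · rw [min_eq_left hle]
    exact (prefix_commonPrefix (commonPrefix_prefix_left _ _)
      ((List.prefix_of_prefix_length_le h1 h2 hle).trans
        (commonPrefix_prefix_right _ _))).length_le
  · rw [min_eq_right hle]
    exact (prefix_commonPrefix ((List.prefix_of_prefix_length_le h2 h1 hle).trans
        (commonPrefix_prefix_left _ _)) (commonPrefix_prefix_right _ _)).length_le

theorem isReduced_invRev {L : List (α × Bool)} (h : FreeGroup.IsReduced L) :
    FreeGroup.IsReduced (FreeGroup.invRev L) := by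
  rw [FreeGroup.isReduced_iff_reduce_eq] at h ⊢
  rw [FreeGroup.reduce_invRev, h]

theorem norm_inv_mul (g h : FreeGroup α) :
    (g⁻¹ * h).norm + 2 * gromov g h = g.norm + h.norm := by
  obtain ⟨A, B, hA, hB, hne⟩ := exists_eq_commonPrefix_append g.toWord h.toWord
  set P := commonPrefix g.toWord h.toWord with hP
  have hrA : FreeGroup.IsReduced A :=
    (FreeGroup.isReduced_toWord (x := g)).infix ⟨P, [], by simpa using hA.symm⟩
  have hrB : FreeGroup.IsReduced B :=
    (FreeGroup.isReduced_toWord (x := h)).infix ⟨P, [], by simpa using hB.symm⟩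
  have hgh : g⁻¹ * h = FreeGroup.mk (FreeGroup.invRev A ++ B) := by
    have hg : g = FreeGroup.mk P * FreeGroup.mk A := by
      rw [FreeGroup.mul_mk, ← hA, FreeGroup.mk_toWord]
    have hh : h = FreeGroup.mk P * FreeGroup.mk B := by
      rw [FreeGroup.mul_mk, ← hB, FreeGroup.mk_toWord]
    rw [← FreeGroup.mul_mk, ← FreeGroup.inv_mk, hg, hh]
    group
  have hred : FreeGroup.IsReduced (FreeGroup.invRev A ++ B) := by
    refine List.isChain_append.2 ⟨isReduced_invRev hrA, hrB, ?_⟩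
    intro x hx y hy hxy
    cases A with
    | nil => simp [FreeGroup.invRev] at hx
    | cons a A =>
      have hxa : x = (a.1, !a.2) := by simpa [FreeGroup.invRev, eq_comm] using hx
      subst hxa
      have := hne a (by simp) y hy
      by_contra hcon
      exact this (Prod.ext hxy (by simpa using hcon))
  have h1 : (g⁻¹ * h).norm = A.length + B.length := by
    rw [hgh, FreeGroup.norm, FreeGroup.toWord_mk, hred.reduce_eq, List.length_append,
      FreeGroup.invRev_length]
  have h2 : g.norm = P.length + A.length := by
    rw [FreeGroup.norm, hA, List.length_append]
  have h3 : h.norm = P.length + B.length := by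
    rw [FreeGroup.norm, hB, List.length_append]
  have h4 : gromov g h = P.length := rfl
  omega

/-- A nontrivial reduced word agrees with its inverse on less than half of its length, since its
middle letter would otherwise be its own inverse, or cancel against the next one. -/
theorem two_mul_gromov_inv_lt {g : FreeGroup α} (hg : g ≠ 1) : 2 * gromov g g⁻¹ < g.norm := by
  by_contra! hcon
  set L := g.toWord with hL
  have hn : 0 < L.length := by
    rw [List.length_pos_iff, Ne, hL, FreeGroup.toWord_eq_nil_iff]; exact hg
  have hlen : g.norm = L.length := rfl
  have hw : g⁻¹.toWord = FreeGroup.invRev L := FreeGroup.toWord_inv g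
  obtain ⟨A, B, hA, hB, -⟩ := exists_eq_commonPrefix_append g.toWord g⁻¹.toWord
  set P := commonPrefix g.toWord g⁻¹.toWord with hP
  have hPlen : gromov g g⁻¹ = P.length := rfl
  have hPL : P.length ≤ L.length := (commonPrefix_prefix_left _ _).length_le
  have key : ∀ i (hi : i < P.length), L[i]'(by omega) =
      ((L[L.length - 1 - i]'(by omega)).1, !(L[L.length - 1 - i]'(by omega)).2) := by
    intro i hi
    have e1 : L[i]'(by omega) = P[i] := by
      have : L = P ++ A := hA
      simp only [this, List.getElem_append_left hi]
    have e2 : (FreeGroup.invRev L)[i]'(by rw [FreeGroup.invRev_length]; omega) = P[i] := by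
      have : FreeGroup.invRev L = P ++ B := by rw [← hw]; exact hB
      simp only [this, List.getElem_append_left hi]
    rw [e1, ← e2]
    simp [FreeGroup.invRev, List.getElem_reverse]
  have hred : FreeGroup.IsReduced L := FreeGroup.isReduced_toWord
  rcases Nat.even_or_odd' L.length with ⟨m, hm | hm⟩
  · have h1 := key (m - 1) (by omega)
    have hidx : L.length - 1 - (m - 1) = m - 1 + 1 := by omega
    simp only [hidx] at h1
    have h2 := List.isChain_iff_getElem.1 hred (m - 1) (by omega)
    have := h2 (by rw [h1])
    rw [h1] at this
    simp at this
  · have h1 := key m (by omega)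
    have hidx : L.length - 1 - m = m := by omega
    simp only [hidx] at h1
    have := congrArg Prod.snd h1
    simp at this

end Cancellation

/-! ### Nielsen reduction for two generators -/

section NielsenMoves

variable {G : Type*} [Group G]

/-- The elementary Nielsen moves on pairs of group elements, together with simultaneous
conjugation. -/
inductive NielsenMove : G × G → G × G → Prop
  | swap (a b : G) : NielsenMove (a, b) (b, a)
  | inv (a b : G) : NielsenMove (a, b) (a⁻¹, b)
  | mul (a b : G) : NielsenMove (a, b) (a, a * b)
  | conj (g a b : G) : NielsenMove (a, b) (g * a * g⁻¹, g * b * g⁻¹)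

/-- Two pairs of group elements are Nielsen equivalent if they are connected by Nielsen moves,
their inverses and simultaneous conjugations. -/
def NielsenEquiv : G × G → G × G → Prop := Relation.EqvGen NielsenMove

namespace NielsenEquiv

theorem refl (s : G × G) : NielsenEquiv s s := Relation.EqvGen.refl s

theorem symm {s t : G × G} (h : NielsenEquiv s t) : NielsenEquiv t s := Relation.EqvGen.symm _ _ h

theorem trans {s t r : G × G} (h : NielsenEquiv s t) (h' : NielsenEquiv t r) :
    NielsenEquiv s r := Relation.EqvGen.trans _ _ _ h h'

theorem swap (a b : G) : NielsenEquiv (a, b) (b, a) :=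
  Relation.EqvGen.rel _ _ (.swap a b)

theorem inv_left (a b : G) : NielsenEquiv (a, b) (a⁻¹, b) :=
  Relation.EqvGen.rel _ _ (.inv a b)

theorem inv_right (a b : G) : NielsenEquiv (a, b) (a, b⁻¹) :=
  (swap a b).trans ((inv_left b a).trans (swap _ _))

theorem mul_left (a b : G) : NielsenEquiv (a, b) (a, a * b) :=
  Relation.EqvGen.rel _ _ (.mul a b)

theorem conj (g a b : G) : NielsenEquiv (a, b) (g * a * g⁻¹, g * b * g⁻¹) :=
  Relation.EqvGen.rel _ _ (.conj g a b)

theorem inv_mul_left (a b : G) : NielsenEquiv (a, b) (a, a⁻¹ * b) := by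
  have := (mul_left a (a⁻¹ * b)).symm
  rwa [mul_inv_cancel_left] at this

theorem mul_right (a b : G) : NielsenEquiv (a, b) (a, b * a) := by
  have := (mul_left a b).trans (conj a⁻¹ a (a * b))
  convert this using 2 <;> group

end NielsenEquiv

/-- A predicate on pairs that every Nielsen move preserves is constant on Nielsen equivalence
classes: the inverse of a Nielsen move is a composition of Nielsen moves. -/
theorem NielsenEquiv.iff_of_move {P : G × G → Prop}
    (hP : ∀ s t, NielsenMove s t → P s → P t) {s t : G × G} (h : NielsenEquiv s t) :
    P s ↔ P t := by
  induction h with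
  | rel s t h =>
    refine ⟨hP s t h, fun ht => ?_⟩
    cases h with
    | swap a b => exact hP _ _ (.swap b a) ht
    | inv a b => simpa using hP _ _ (.inv a⁻¹ b) ht
    | mul a b =>
      have h1 := hP _ _ (.mul a⁻¹ (a * b)) (hP _ _ (.inv a (a * b)) ht)
      simpa using hP _ _ (.inv a⁻¹ _) h1
    | conj g a b =>
      have h1 := hP _ _ (.conj g⁻¹ _ _) ht
      convert h1 using 2 <;> group
  | refl => exact Iff.rfl
  | symm _ _ _ ih => exact ih.symm
  | trans _ _ _ _ _ ih ih' => exact ih.trans ih'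

theorem NielsenEquiv.closure_eq_top_iff {s t : G × G} (h : NielsenEquiv s t) :
    Subgroup.closure {s.1, s.2} = ⊤ ↔ Subgroup.closure {t.1, t.2} = ⊤ := by
  refine h.iff_of_move (P := fun s => Subgroup.closure {s.1, s.2} = ⊤) ?_
  intro s t hst hs
  have key : ∀ H : Subgroup G, s.1 ∈ H → s.2 ∈ H → H = ⊤ := by
    intro H h1 h2
    rw [eq_top_iff, ← hs, Subgroup.closure_le]
    rintro x (rfl | rfl)
    exacts [h1, h2]
  cases hst with
  | swap a b => exact key _ (Subgroup.subset_closure (by simp)) (Subgroup.subset_closure (by simp))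
  | inv a b =>
    refine key _ ?_ (Subgroup.subset_closure (by simp))
    have : a⁻¹ ∈ Subgroup.closure {a⁻¹, b} := Subgroup.subset_closure (by simp)
    simpa using inv_mem this
  | mul a b =>
    have h1 : a ∈ Subgroup.closure {a, a * b} := Subgroup.subset_closure (by simp)
    have h2 : a * b ∈ Subgroup.closure {a, a * b} := Subgroup.subset_closure (by simp)
    refine key _ h1 ?_
    have := mul_mem (inv_mem h1) h2
    rwa [inv_mul_cancel_left] at this
  | conj g a b =>
    have h1 : (Subgroup.closure {a, b}).map (MulAut.conj g).toMonoidHom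
        = Subgroup.closure {g * a * g⁻¹, g * b * g⁻¹} := by
      rw [MonoidHom.map_closure, Set.image_pair]
      rfl
    have hs' : Subgroup.closure {a, b} = ⊤ := hs
    show Subgroup.closure {g * a * g⁻¹, g * b * g⁻¹} = ⊤
    rw [← h1, hs', ← MonoidHom.range_eq_map, MonoidHom.range_eq_top]
    exact (MulAut.conj g).surjective

end NielsenMoves

section NielsenReduced

variable {α ι : Type*} [DecidableEq α]

/-- In a Nielsen reduced family, given by its letters `s (i, true)` and `s (i, false)`, every
letter of a reduced word keeps at least one uncancelled symbol. The statement also bounds the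
part of the product that a preceding letter `x` can cancel, as the induction requires. -/
theorem length_add_gromov_le_norm_prod {s : ι × Bool → FreeGroup α}
    (h1 : ∀ x y : ι × Bool, (x.1 = y.1 → x.2 = y.2) → gromov (s x)⁻¹ (s y) < (s y).norm)
    (h2 : ∀ x y z : ι × Bool, (x.1 = y.1 → x.2 = y.2) → (y.1 = z.1 → y.2 = z.2) →
      gromov (s x)⁻¹ (s y) + gromov (s y)⁻¹ (s z) < (s y).norm)
    (L : List (ι × Bool)) (x y : ι × Bool) (hL : FreeGroup.IsReduced (x :: y :: L)) :
    gromov (s x)⁻¹ ((y :: L).map s).prod = gromov (s x)⁻¹ (s y) ∧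
      (y :: L).length + gromov (s x)⁻¹ (s y) ≤ ((y :: L).map s).prod.norm := by
  induction L generalizing x y with
  | nil =>
    have := h1 x y (FreeGroup.isReduced_cons_cons.1 hL).1
    simp
    omega
  | cons z L ih =>
    obtain ⟨hxy, hL'⟩ := FreeGroup.isReduced_cons_cons.1 hL
    obtain ⟨hyz, -⟩ := FreeGroup.isReduced_cons_cons.1 hL'
    obtain ⟨ih1, ih2⟩ := ih y z hL'
    have h := h2 x y z hxy hyz
    set P := ((z :: L).map s).prod with hP
    have e1 := norm_inv_mul (s y) (s y * P)
    have e2 := norm_inv_mul (s y)⁻¹ P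
    rw [inv_mul_cancel_left] at e1
    rw [inv_inv, FreeGroup.norm_inv_eq] at e2
    have hprod : ((y :: z :: L).map s).prod = s y * P := by simp [hP]
    rw [hprod]
    constructor
    · have u1 := min_gromov_le (s x)⁻¹ (s y) (s y * P)
      have u2 := min_gromov_le (s x)⁻¹ (s y * P) (s y)
      rw [gromov_comm (s y * P)] at u2
      omega
    · simp only [List.length_cons] at ih2 ⊢
      omega

end NielsenReduced

section Minimal

variable {α : Type*} [DecidableEq α]

/-- A pair of elements of a free group is minimal if no Nielsen equivalent pair has a smaller
total length. -/
def IsMinimalPair (u v : FreeGroup α) : Prop :=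
  ∀ t, NielsenEquiv (u, v) t → u.norm + v.norm ≤ t.1.norm + t.2.norm

theorem exists_isMinimalPair (s : FreeGroup α × FreeGroup α) :
    ∃ u v, NielsenEquiv s (u, v) ∧ IsMinimalPair u v := by
  classical
  have hne : ∃ n, ∃ t, NielsenEquiv s t ∧ t.1.norm + t.2.norm = n := ⟨_, s, .refl s, rfl⟩
  obtain ⟨t, ht, hn⟩ := Nat.find_spec hne
  refine ⟨t.1, t.2, ht, fun r hr => ?_⟩
  rw [hn]
  exact Nat.find_min' hne ⟨r, ht.trans hr, rfl⟩

theorem IsMinimalPair.swap {u v : FreeGroup α} (h : IsMinimalPair u v) : IsMinimalPair v u := by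
  intro t ht
  rw [add_comm]
  exact h t ((NielsenEquiv.swap u v).trans ht)

theorem IsMinimalPair.inv_left {u v : FreeGroup α} (h : IsMinimalPair u v) :
    IsMinimalPair u⁻¹ v := by
  intro t ht
  rw [FreeGroup.norm_inv_eq]
  exact h t ((NielsenEquiv.inv_left u v).trans ht)

theorem IsMinimalPair.inv_right {u v : FreeGroup α} (h : IsMinimalPair u v) :
    IsMinimalPair u v⁻¹ := h.swap.inv_left.swap

theorem IsMinimalPair.two_mul_gromov_le {u v : FreeGroup α} (h : IsMinimalPair u v) :
    2 * gromov u v ≤ u.norm := by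
  have h1 := h _ (NielsenEquiv.inv_mul_left u v)
  have h2 := norm_inv_mul u v
  dsimp only at h1
  omega

/-- If `v = p * q⁻¹` with halves `p` and `q` of equal length, and `u` starts with `p` and ends
with `q⁻¹`, say `u = p * w * q⁻¹`, then conjugating `(u * v⁻¹, v)` by `p` gives the shorter pair
`(w, q⁻¹ * p)`. -/
theorem IsMinimalPair.not_half_half {u v : FreeGroup α} (h : IsMinimalPair u v) (hv : v ≠ 1)
    (h1 : 2 * gromov u v = v.norm) (h2 : 2 * gromov u⁻¹ v⁻¹ = v.norm) : False := by
  have hu := h.two_mul_gromov_le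
  set P := commonPrefix u.toWord v.toWord with hP
  set Q := commonPrefix u⁻¹.toWord v⁻¹.toWord with hQ
  have hPl : gromov u v = P.length := rfl
  have hQl : gromov u⁻¹ v⁻¹ = Q.length := rfl
  have hul : u.norm = u.toWord.length := rfl
  have hvl : v.norm = v.toWord.length := rfl
  obtain ⟨A, hA⟩ := commonPrefix_prefix_left u.toWord v.toWord
  obtain ⟨B, hB⟩ := commonPrefix_prefix_right u.toWord v.toWord
  rw [← hP] at hA hB
  have sufu : FreeGroup.invRev Q <:+ u.toWord := by
    obtain ⟨C, hC⟩ := commonPrefix_prefix_left u⁻¹.toWord v⁻¹.toWord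
    refine ⟨FreeGroup.invRev C, ?_⟩
    rw [← FreeGroup.invRev_append, hC, FreeGroup.toWord_inv, FreeGroup.invRev_invRev]
  have sufv : FreeGroup.invRev Q <:+ v.toWord := by
    obtain ⟨C, hC⟩ := commonPrefix_prefix_right u⁻¹.toWord v⁻¹.toWord
    refine ⟨FreeGroup.invRev C, ?_⟩
    rw [← FreeGroup.invRev_append, hC, FreeGroup.toWord_inv, FreeGroup.invRev_invRev]
  have lA : u.toWord.length = P.length + A.length := by rw [← hA, List.length_append]
  have lB : v.toWord.length = P.length + B.length := by rw [← hB, List.length_append]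
  have lQ : (FreeGroup.invRev Q).length = Q.length := FreeGroup.invRev_length
  have hBQ : FreeGroup.invRev Q = B :=
    (List.suffix_of_suffix_length_le sufv ⟨P, hB⟩ (by omega)).eq_of_length (by omega)
  obtain ⟨W, hW⟩ := List.suffix_of_suffix_length_le sufu ⟨P, hA⟩ (by omega)
  have lW : A.length = W.length + Q.length := by rw [← hW, List.length_append, lQ]
  set p := FreeGroup.mk P
  set q := FreeGroup.mk Q
  set w := FreeGroup.mk W
  have hv' : v = p * q⁻¹ := by
    rw [← FreeGroup.mk_toWord (x := v), ← hB, ← hBQ, ← FreeGroup.mul_mk, ← FreeGroup.inv_mk]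
  have hu' : u = p * w * q⁻¹ := by
    rw [← FreeGroup.mk_toWord (x := u), ← hA, ← hW, ← FreeGroup.mul_mk, ← FreeGroup.mul_mk,
      ← FreeGroup.inv_mk, mul_assoc]
  have hequiv : NielsenEquiv (u, v) (w, q⁻¹ * p) := by
    have e1 : NielsenEquiv (u, v) (u * v⁻¹, v) :=
      (NielsenEquiv.swap u v).trans ((NielsenEquiv.inv_left v u).trans
        ((NielsenEquiv.mul_right v⁻¹ u).trans
          ((NielsenEquiv.inv_left v⁻¹ _).trans (NielsenEquiv.swap _ _)))) |>.trans (by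
            rw [inv_inv]; exact .refl _)
    have e2 := e1.trans (NielsenEquiv.conj p⁻¹ (u * v⁻¹) v)
    convert e2 using 2
    · rw [hu', hv']; group
    · rw [hv']; group
  have hmin := h _ hequiv
  have n1 : w.norm ≤ W.length := FreeGroup.norm_mk_le
  have n2 : (q⁻¹ * p).norm ≤ q⁻¹.norm + p.norm := FreeGroup.norm_mul_le _ _
  have n3 : q.norm ≤ Q.length := FreeGroup.norm_mk_le
  have n4 : p.norm ≤ P.length := FreeGroup.norm_mk_le
  rw [FreeGroup.norm_inv_eq] at n2
  have hv0 : v.norm ≠ 0 := by rwa [Ne, FreeGroup.norm_eq_zero]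
  dsimp only at hmin
  omega

end Minimal

section NielsenTheorem

/-- The letter of a pair `(u, v)`: one of `u`, `v` and their inverses. -/
def pairLetter {G : Type*} [Group G] (u v : G) (x : Fin 2 × Bool) : G :=
  cond x.2 (![u, v] x.1) (![u, v] x.1)⁻¹

theorem pairLetter_not {G : Type*} [Group G] (u v : G) (x : Fin 2 × Bool) :
    pairLetter u v (x.1, !x.2) = (pairLetter u v x)⁻¹ := by
  obtain ⟨i, b⟩ := x
  cases b <;> simp [pairLetter]

variable {α : Type*} [DecidableEq α]

theorem IsMinimalPair.pairLetter {u v : FreeGroup α} (h : IsMinimalPair u v)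
    {x y : Fin 2 × Bool} (hxy : x.1 ≠ y.1) :
    IsMinimalPair (pairLetter u v x) (pairLetter u v y) := by
  obtain ⟨i, b⟩ := x
  obtain ⟨j, c⟩ := y
  dsimp only at hxy
  have key : ∀ b c : Bool, IsMinimalPair (cond b u u⁻¹) (cond c v v⁻¹) := by
    rintro (_ | _) (_ | _)
    exacts [h.inv_left.inv_right, h.inv_left, h.inv_right, h]
  fin_cases i <;> fin_cases j
  · exact absurd rfl hxy
  · exact key b c
  · exact (key c b).swap
  · exact absurd rfl hxy

/-- A minimal pair is Nielsen reduced: a letter is never cancelled completely by its neighbours.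
The only critical case, that of two equal halves, is `IsMinimalPair.not_half_half`. -/
theorem IsMinimalPair.length_le_norm_lift {u v : FreeGroup α} (h : IsMinimalPair u v)
    (hu : u ≠ 1) (hv : v ≠ 1) (w : FreeGroup (Fin 2)) :
    w.norm ≤ (FreeGroup.lift ![u, v] w).norm := by
  set s := ImaginaryCharacters.pairLetter u v with hs
  have hs1 : ∀ x, s x ≠ 1 := by
    rintro ⟨i, b⟩
    fin_cases i <;> cases b <;> simpa [hs, ImaginaryCharacters.pairLetter]
  have hnorm : ∀ x, 0 < (s x).norm := fun x =>
    Nat.pos_of_ne_zero (by rw [Ne, FreeGroup.norm_eq_zero]; exact hs1 x)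
  have hself : ∀ x, 2 * gromov (s x)⁻¹ (s x) < (s x).norm := fun x => by
    rw [gromov_comm]; exact two_mul_gromov_inv_lt (hs1 x)
  have hmin : ∀ x y : Fin 2 × Bool, x.1 ≠ y.1 → IsMinimalPair (s x)⁻¹ (s y) := fun x y hxy =>
    (h.pairLetter hxy).inv_left
  have half : ∀ x y : Fin 2 × Bool, (x.1 = y.1 → x.2 = y.2) →
      2 * gromov (s x)⁻¹ (s y) ≤ (s x).norm ∧ 2 * gromov (s x)⁻¹ (s y) ≤ (s y).norm := by
    intro x y hxy
    by_cases hi : x.1 = y.1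
    · obtain rfl : x = y := Prod.ext hi (hxy hi)
      exact ⟨(hself x).le, (hself x).le⟩
    · have e1 := (hmin x y hi).two_mul_gromov_le
      have e2 := (hmin x y hi).swap.two_mul_gromov_le
      rw [gromov_comm] at e2
      rw [FreeGroup.norm_inv_eq] at e1
      exact ⟨e1, e2⟩
  have h1 : ∀ x y : Fin 2 × Bool, (x.1 = y.1 → x.2 = y.2) →
      gromov (s x)⁻¹ (s y) < (s y).norm := by
    intro x y hxy
    have := (half x y hxy).2
    have := hnorm y
    omega
  have h2 : ∀ x y z : Fin 2 × Bool, (x.1 = y.1 → x.2 = y.2) → (y.1 = z.1 → y.2 = z.2) →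
      gromov (s x)⁻¹ (s y) + gromov (s y)⁻¹ (s z) < (s y).norm := by
    intro x y z hxy hyz
    have a1 := (half x y hxy).2
    have a2 := (half y z hyz).1
    by_contra! hcon
    have b1 : 2 * gromov (s x)⁻¹ (s y) = (s y).norm := by omega
    have b2 : 2 * gromov (s y)⁻¹ (s z) = (s y).norm := by omega
    have hi : x.1 ≠ y.1 := by
      intro hi
      obtain rfl : x = y := Prod.ext hi (hxy hi)
      exact (hself x).ne b1
    have hj : y.1 ≠ z.1 := by
      intro hj
      obtain rfl : y = z := Prod.ext hj (hyz hj)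
      exact (hself y).ne b2
    have hxz : x.1 = z.1 := by omega
    by_cases hb : x.2 = z.2
    · obtain rfl : x = z := Prod.ext hxz hb
      refine (hmin x y hi).not_half_half (hs1 y) b1 ?_
      rw [inv_inv, gromov_comm]
      exact b2
    · have hz : s z = (s x)⁻¹ := by
        rw [hs, ← pairLetter_not]
        congr 1
        refine Prod.ext hxz.symm ?_
        cases hx2 : x.2 <;> cases hz2 : z.2 <;> simp_all
      rw [hz] at b2
      have e := min_gromov_le (s y)⁻¹ (s x)⁻¹ (s y)
      have := hself y
      omega
  have hlift : FreeGroup.lift ![u, v] w = (w.toWord.map s).prod := by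
    conv_lhs => rw [← FreeGroup.mk_toWord (x := w)]
    rw [FreeGroup.lift_mk]
    rfl
  rw [hlift]
  have hred : FreeGroup.IsReduced w.toWord := FreeGroup.isReduced_toWord
  rw [FreeGroup.norm]
  cases hw : w.toWord with
  | nil => simp
  | cons y L =>
    rw [hw] at hred
    have := (length_add_gromov_le_norm_prod h1 h2 L y y
      (FreeGroup.isReduced_cons_cons.2 ⟨fun _ => rfl, hred⟩)).2
    omega

theorem genX_mul_genY_ne : genX * genY ≠ genY * genX := by
  unfold genX genY
  decide

theorem closure_pair_ne_top {u v : F2} (h : Commute u v) : Subgroup.closure {u, v} ≠ ⊤ := by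
  intro htop
  have hle : Subgroup.closure {u, v} ≤ Subgroup.centralizer {u, v} := by
    rw [Subgroup.closure_le]
    rintro x (rfl | rfl) <;> rw [SetLike.mem_coe, Subgroup.mem_centralizer_iff]
    · rintro y (rfl | rfl)
      exacts [rfl, h.symm]
    · rintro y (rfl | rfl)
      exacts [h, rfl]
  have hle2 : Subgroup.closure {u, v} ≤ Subgroup.centralizer (⊤ : Subgroup F2) := by
    rw [← htop, Subgroup.centralizer_closure]
    exact hle
  rw [htop] at hle2
  have := Subgroup.mem_centralizer_iff.1 (hle2 (Subgroup.mem_top genX)) genY (Subgroup.mem_top _)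
  exact genX_mul_genY_ne this.symm

/-- Nielsen's theorem in rank two: every pair generating the free group is Nielsen equivalent to
the standard basis. -/
theorem nielsenEquiv_gen {u v : F2} (h : Subgroup.closure {u, v} = ⊤) :
    NielsenEquiv (u, v) (genX, genY) := by
  obtain ⟨a, b, hequiv, hmin⟩ := exists_isMinimalPair (u, v)
  refine hequiv.trans ?_
  have hab : Subgroup.closure {a, b} = ⊤ := hequiv.closure_eq_top_iff.1 h
  have ha : a ≠ 1 := fun h1 => closure_pair_ne_top (h1 ▸ Commute.one_left b) hab
  have hb : b ≠ 1 := fun h1 => closure_pair_ne_top (h1 ▸ Commute.one_right a) hab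
  have hsurj : Function.Surjective (FreeGroup.lift ![a, b] : F2 →* F2) := by
    rw [FreeGroup.lift_surjective_iff_closure_range_eq_top, Matrix.range_cons_cons_empty]
    exact hab
  have key : ∀ i : Fin 2, ∃ x, FreeGroup.of i = pairLetter a b x := by
    intro i
    obtain ⟨w, hw⟩ := hsurj (FreeGroup.of i)
    have hle := hmin.length_le_norm_lift ha hb w
    rw [hw, FreeGroup.norm_of] at hle
    rw [← hw]
    conv => enter [1, x, 1]; rw [← FreeGroup.mk_toWord (x := w)]
    rw [FreeGroup.norm] at hle
    match hL : w.toWord with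
    | [] =>
      have : w = 1 := FreeGroup.toWord_eq_nil_iff.1 hL
      rw [this, map_one] at hw
      exact absurd hw (FreeGroup.one_ne_of i)
    | [x] =>
      refine ⟨x, ?_⟩
      rw [FreeGroup.lift_mk]
      simp [pairLetter]
    | x :: y :: L => simp [hL] at hle
  obtain ⟨⟨i, c⟩, hx⟩ := key 0
  obtain ⟨⟨j, d⟩, hy⟩ := key 1
  have hX : genX = pairLetter a b (i, c) := hx
  have hY : genY = pairLetter a b (j, d) := hy
  have hinv : ∀ c d : Bool, NielsenEquiv (a, b) (cond c a a⁻¹, cond d b b⁻¹) := by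
    rintro (_ | _) (_ | _)
    exacts [(NielsenEquiv.inv_left a b).trans (.inv_right _ _), .inv_left a b, .inv_right a b,
      .refl _]
  have hij : i ≠ j := by
    rintro rfl
    apply genX_mul_genY_ne
    rw [hX, hY]
    cases c <;> cases d <;> simp [pairLetter]
  rw [hX, hY]
  fin_cases i <;> fin_cases j
  · exact absurd rfl hij
  · exact hinv c d
  · exact (hinv d c).trans (.swap _ _)
  · exact absurd rfl hij

theorem closure_freeGroupBasis (b : FreeGroupBasis (Fin 2) F2) :
    Subgroup.closure {b 0, b 1} = ⊤ := by
  have h1 : Set.range b = {b 0, b 1} := by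
    ext x
    simp [Fin.exists_fin_two, eq_comm]
  have h2 : Set.range b = b.repr.symm '' Set.range FreeGroup.of := by
    rw [← Set.range_comp]
    rfl
  rw [← h1, h2]
  have := MonoidHom.map_closure (b.repr.symm.toMonoidHom) (Set.range FreeGroup.of)
  rw [FreeGroup.closure_range_of, ← MonoidHom.range_eq_map,
    MonoidHom.range_eq_top.2 b.repr.symm.surjective] at this
  exact this.symm

end NielsenTheorem

/-! ### The Stern-Brocot tree of primitive elements -/

section SternBrocot

variable {G : Type*} [Group G]

/-- The nodes at a given depth of the Stern-Brocot tree grown from a pair `(a, b)`: a node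
`(p, q)` has the two children `(p, p * q)` and `(p * q, q)`. -/
inductive SternBrocot (a b : G) : ℕ → G → G → Prop
  | root : SternBrocot a b 0 a b
  | left {n : ℕ} {p q : G} : SternBrocot a b n p q → SternBrocot a b (n + 1) p (p * q)
  | right {n : ℕ} {p q : G} : SternBrocot a b n p q → SternBrocot a b (n + 1) (p * q) q

/-- The pairs that are obtained from the nodes of the two trees grown from `(a, b)` and
`(a⁻¹, b)` by exchanging and inverting entries and by simultaneous conjugation. -/
inductive SternBrocotPair (a b : G) : G → G → Prop
  | node {n : ℕ} {p q : G} (h : SternBrocot a b n p q) : SternBrocotPair a b p q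
  | node_inv {n : ℕ} {p q : G} (h : SternBrocot a⁻¹ b n p q) : SternBrocotPair a b p q
  | swap {p q : G} (h : SternBrocotPair a b p q) : SternBrocotPair a b q p
  | inv {p q : G} (h : SternBrocotPair a b p q) : SternBrocotPair a b p⁻¹ q
  | conj {p q : G} (g : G) (h : SternBrocotPair a b p q) :
      SternBrocotPair a b (g * p * g⁻¹) (g * q * g⁻¹)

theorem SternBrocotPair.inv_right {a b p q : G} (h : SternBrocotPair a b p q) :
    SternBrocotPair a b p q⁻¹ := h.swap.inv.swap

/-- Below the root, the quotient `p⁻¹ * q` undoes the last step of the Stern-Brocot tree. -/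
theorem SternBrocot.quotient {a b c d p q : G} {n : ℕ}
    (hnode : ∀ {n p q}, SternBrocot a b n p q → SternBrocotPair c d p q)
    (hroot : SternBrocotPair c d a (a⁻¹ * b) ∧ SternBrocotPair c d (a⁻¹ * b) b)
    (h : SternBrocot a b n p q) :
    SternBrocotPair c d p (p⁻¹ * q) ∧ SternBrocotPair c d (p⁻¹ * q) q := by
  cases h with
  | root => exact hroot
  | @left n p q h =>
    rw [inv_mul_cancel_left]
    exact ⟨hnode h, (hnode h.right).swap⟩
  | @right n p q h =>
    constructor
    · have := (hnode h.left).inv.swap.conj (p * q)⁻¹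
      convert this using 1 <;> group
    · have := (hnode h).inv.conj q⁻¹
      convert this using 1 <;> group

theorem SternBrocotPair.mul_quotient {a b u v : G} (h : SternBrocotPair a b u v) :
    (SternBrocotPair a b u (u * v) ∧ SternBrocotPair a b (u * v) v) ∧
      (SternBrocotPair a b u (u⁻¹ * v) ∧ SternBrocotPair a b (u⁻¹ * v) v) := by
  induction h with
  | node h =>
    refine ⟨⟨.node h.left, .node h.right⟩, h.quotient .node ⟨?_, .node_inv (.right .root)⟩⟩
    have := (SternBrocotPair.node_inv (a := a) (b := b) (.left .root)).inv
    rwa [inv_inv] at this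
  | node_inv h =>
    refine ⟨⟨.node_inv h.left, .node_inv h.right⟩, h.quotient .node_inv ⟨?_, ?_⟩⟩
    · rw [inv_inv]
      exact (SternBrocotPair.node (.left .root)).inv
    · rw [inv_inv]
      exact .node (.right .root)
  | @swap u v _ ih =>
    obtain ⟨⟨h1, h2⟩, h3, h4⟩ := ih
    refine ⟨⟨?_, ?_⟩, ?_, ?_⟩
    · convert h2.swap.conj v using 1 <;> group
    · convert h1.swap.conj u⁻¹ using 1 <;> group
    · convert h4.swap.inv_right using 1; group
    · convert h3.swap.inv using 1; group
  | inv _ ih =>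
    obtain ⟨⟨h1, h2⟩, h3, h4⟩ := ih
    rw [inv_inv]
    exact ⟨⟨h3.inv, h4⟩, h1.inv, h2⟩
  | conj g _ ih =>
    obtain ⟨⟨h1, h2⟩, h3, h4⟩ := ih
    refine ⟨⟨?_, ?_⟩, ?_, ?_⟩
    · convert h1.conj g using 1; group
    · convert h2.conj g using 1; group
    · convert h3.conj g using 1; group
    · convert h4.conj g using 1; group

/-- The Stern-Brocot trees of `(a, b)` and `(a⁻¹, b)` exhaust the Nielsen class of `(a, b)`, up to
exchanges, inversions and conjugation. -/
theorem NielsenEquiv.sternBrocotPair {a b : G} {s : G × G} (h : NielsenEquiv (a, b) s) :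
    SternBrocotPair a b s.1 s.2 := by
  refine (h.iff_of_move (P := fun s => SternBrocotPair a b s.1 s.2) ?_).1 (.node .root)
  intro s t hst hs
  cases hst with
  | swap u v => exact hs.swap
  | inv u v => exact hs.inv
  | mul u v => exact hs.mul_quotient.1.1
  | conj g u v => exact hs.conj g

/-- Equality of group elements up to conjugation and inversion. -/
def ConjInv (g h : G) : Prop := IsConj g h ∨ IsConj g h⁻¹

theorem isConj_inv {g h : G} (e : IsConj g h) : IsConj g⁻¹ h⁻¹ := by
  obtain ⟨c, hc⟩ := isConj_iff.1 e
  exact isConj_iff.2 ⟨c, by rw [← hc]; group⟩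

theorem ConjInv.symm {g h : G} (e : ConjInv g h) : ConjInv h g := by
  rcases e with e | e
  · exact .inl e.symm
  · have := isConj_inv e.symm
    rw [inv_inv] at this
    exact .inr this

theorem ConjInv.trans {g h l : G} (e : ConjInv g h) (f : ConjInv h l) : ConjInv g l := by
  rcases e with e | e <;> rcases f with f | f
  · exact .inl (e.trans f)
  · exact .inr (e.trans f)
  · exact .inr (e.trans (isConj_inv f))
  · have := isConj_inv f
    rw [inv_inv] at this
    exact .inl (e.trans this)

theorem ConjInv.refl (g : G) : ConjInv g g := .inl (IsConj.refl g)

theorem conjInv_inv (g : G) : ConjInv g⁻¹ g := .inr (IsConj.refl _)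

theorem conjInv_conj (g h : G) : ConjInv (h * g * h⁻¹) g := .inl (isConj_iff.2 ⟨h⁻¹, by group⟩)

theorem SternBrocot.entries {a b p q : G} {n : ℕ} (h : SternBrocot a b n p q) :
    (p = a ∨ ∃ m p' q', SternBrocot a b m p' q' ∧ p = p' * q') ∧
      (q = b ∨ ∃ m p' q', SternBrocot a b m p' q' ∧ q = p' * q') := by
  induction h with
  | root => exact ⟨.inl rfl, .inl rfl⟩
  | left h ih => exact ⟨ih.1, .inr ⟨_, _, _, h, rfl⟩⟩
  | right h ih => exact ⟨.inr ⟨_, _, _, h, rfl⟩, ih.2⟩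

theorem SternBrocot.split {a b p q : G} {n : ℕ} (h : SternBrocot a b n p q) :
    (p = a ∧ q = b) ∨ (∃ m, SternBrocot a (a * b) m p q) ∨ ∃ m, SternBrocot (a * b) b m p q := by
  induction h with
  | root => exact .inl ⟨rfl, rfl⟩
  | left h ih =>
    rcases ih with ⟨rfl, rfl⟩ | ⟨m, hm⟩ | ⟨m, hm⟩
    exacts [.inr (.inl ⟨0, .root⟩), .inr (.inl ⟨_, hm.left⟩), .inr (.inr ⟨_, hm.left⟩)]
  | right h ih =>
    rcases ih with ⟨rfl, rfl⟩ | ⟨m, hm⟩ | ⟨m, hm⟩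
    exacts [.inr (.inr ⟨0, .root⟩), .inr (.inl ⟨_, hm.right⟩), .inr (.inr ⟨_, hm.right⟩)]

/-- The products `p * q` over the nodes of the Stern-Brocot tree of `(a, b)`. -/
def IsSternBrocotMul (a b : G) (n : ℕ) (g : G) : Prop :=
  ∃ p q, SternBrocot a b n p q ∧ g = p * q

theorem finite_sternBrocot (a b : G) (n : ℕ) :
    {s : G × G | SternBrocot a b n s.1 s.2}.Finite := by
  induction n with
  | zero =>
    refine (Set.finite_singleton (a, b)).subset ?_
    rintro ⟨p, q⟩ h
    cases h
    rfl
  | succ n ih =>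
    refine ((ih.image fun s => (s.1, s.1 * s.2)).union
      (ih.image fun s => (s.1 * s.2, s.2))).subset ?_
    rintro ⟨p, q⟩ h
    simp only [Set.mem_ofPred_eq] at h
    cases h with
    | @left n p q h => exact .inl ⟨(p, q), h, rfl⟩
    | @right n p q h => exact .inr ⟨(p, q), h, rfl⟩

theorem finite_isSternBrocotMul (a b : G) (N : ℕ) :
    {g : G | ∃ n ≤ N, IsSternBrocotMul a b n g}.Finite := by
  have := (Set.finite_Iic N).biUnion fun n _ =>
    (finite_sternBrocot a b n).image fun s => s.1 * s.2
  refine this.subset ?_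
  rintro g ⟨n, hn, p, q, h, rfl⟩
  exact Set.mem_biUnion (show n ∈ Set.Iic N from hn) ⟨(p, q), h, rfl⟩

/-- Every entry of a Stern-Brocot pair is, up to conjugation and inversion, an entry of the
basis or a product over a node of one of the three subtrees behind the edges of the vertex
`{a, b, a * b}`. -/
theorem SternBrocotPair.entries {a b u v : G} (h : SternBrocotPair a b u v) :
    let E := fun u => ∃ g, ConjInv u g ∧ (g = a ∨ g = b ∨ g = a * b ∨
      ∃ n, IsSternBrocotMul a⁻¹ b n g ∨ IsSternBrocotMul a (a * b) n g ∨
        IsSternBrocotMul (a * b) b n g)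
    E u ∧ E v := by
  intro E
  have hmul : ∀ {n p q}, SternBrocot a b n p q → E (p * q) := by
    intro n p q h
    refine ⟨p * q, .refl _, ?_⟩
    rcases h.split with ⟨rfl, rfl⟩ | ⟨m, hm⟩ | ⟨m, hm⟩
    · exact .inr (.inr (.inl rfl))
    · exact .inr (.inr (.inr ⟨m, .inr (.inl ⟨p, q, hm, rfl⟩)⟩))
    · exact .inr (.inr (.inr ⟨m, .inr (.inr ⟨p, q, hm, rfl⟩)⟩))
  have hmul' : ∀ {n p q}, SternBrocot a⁻¹ b n p q → E (p * q) := fun {n p q} h =>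
    ⟨p * q, .refl _, .inr (.inr (.inr ⟨n, .inl ⟨p, q, h, rfl⟩⟩))⟩
  have ha : E a := ⟨a, .refl a, .inl rfl⟩
  have hb : E b := ⟨b, .refl b, .inr (.inl rfl)⟩
  have hE : ∀ {g h : G}, ConjInv g h → E h → E g := fun e ⟨r, hr, hr'⟩ => ⟨r, e.trans hr, hr'⟩
  induction h with
  | node h =>
    obtain ⟨h1, h2⟩ := h.entries
    constructor
    · rcases h1 with rfl | ⟨m, p', q', h', rfl⟩
      exacts [ha, hmul h']
    · rcases h2 with rfl | ⟨m, p', q', h', rfl⟩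
      exacts [hb, hmul h']
  | node_inv h =>
    obtain ⟨h1, h2⟩ := h.entries
    constructor
    · rcases h1 with rfl | ⟨m, p', q', h', rfl⟩
      exacts [hE (conjInv_inv a) ha, hmul' h']
    · rcases h2 with rfl | ⟨m, p', q', h', rfl⟩
      exacts [hb, hmul' h']
  | swap _ ih => exact ih.symm
  | inv _ ih => exact ⟨hE (conjInv_inv _) ih.1, ih.2⟩
  | conj g _ ih => exact ⟨hE (conjInv_conj _ _) ih.1, hE (conjInv_conj _ _) ih.2⟩

/-- Every primitive class occurs in the tree: at a given vertex or behind one of its edges. -/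
theorem IsPrimitive.exists_conjInv {a b : F2} (h : NielsenEquiv (a, b) (genX, genY)) {u : F2}
    (hu : IsPrimitive u) :
    ∃ g, ConjInv u g ∧ (g = a ∨ g = b ∨ g = a * b ∨
      ∃ n, IsSternBrocotMul a⁻¹ b n g ∨ IsSternBrocotMul a (a * b) n g ∨
        IsSternBrocotMul (a * b) b n g) := by
  obtain ⟨B, i, rfl⟩ := hu
  have key := (h.trans (nielsenEquiv_gen (closure_freeGroupBasis B)).symm).sternBrocotPair.entries
  fin_cases i
  exacts [key.1, key.2]

end SternBrocot

/-! ### Growth of traces away from a sink -/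

theorem tr_mul (ρ : F2 →* SL2C) (g h : F2) :
    tr ρ (g * h) = tr ρ g * tr ρ h - tr ρ (g⁻¹ * h) := by
  simp [tr, Matrix.trace_fin_two, Matrix.SpecialLinearGroup.coe_inv, Matrix.adjugate_fin_two,
    Matrix.mul_apply, Matrix.vecMul, dotProduct, Fin.sum_univ_two]
  ring

theorem tr_mul_comm (ρ : F2 →* SL2C) (g h : F2) : tr ρ (g * h) = tr ρ (h * g) :=
  tr_conj ρ (isConj_iff.2 ⟨g⁻¹, by group⟩)

theorem tr_mul_mul_left (ρ : F2 →* SL2C) (p q : F2) :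
    tr ρ (p * (p * q)) = tr ρ p * tr ρ (p * q) - tr ρ q := by
  rw [tr_mul, inv_mul_cancel_left]

theorem tr_mul_mul_right (ρ : F2 →* SL2C) (p q : F2) :
    tr ρ (p * q * q) = tr ρ q * tr ρ (p * q) - tr ρ p := by
  rw [tr_mul_comm, tr_mul, tr_mul_comm ρ q⁻¹, mul_inv_cancel_right]

section Growth

/-- A lower bound for the increase of a trace along an edge leading away from a sink, when the
imaginary traces are at least `m` and the real ones at least `r` in absolute value. -/
noncomputable def minGrowth (m r : ℝ) : ℝ := min (m ^ 2) (min (2 * m) ((r ^ 2 / 2 - 2) * m))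

theorem minGrowth_pos {m r : ℝ} (hm : 0 < m) (hr : 2 < r) : 0 < minGrowth m r := by
  have : 0 < r ^ 2 / 2 - 2 := by nlinarith
  unfold minGrowth
  positivity

variable {m r x y z : ℝ}

theorem abs_add_minGrowth_le_of_mul_neg (hr : 2 < r) (hm : 0 < m) (hy : m ≤ |y|) (hz : r ≤ |z|)
    (h : x * y * z < 0) : |x| + minGrowth m r ≤ |y * z - x| := by
  have h1 : |y * z - x| = |y * z| + |x| := by
    rw [sub_eq_add_neg, ← abs_neg x]
    exact (abs_add_eq_add_abs_iff _ _).2 (by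
      rcases le_total 0 x with hx | hx
      · exact .inr ⟨by nlinarith, by linarith⟩
      · exact .inl ⟨by nlinarith, by linarith⟩)
  have h2 : minGrowth m r ≤ 2 * m := (min_le_right _ _).trans (min_le_left _ _)
  have h3 : 2 * m ≤ |y * z| := by rw [abs_mul]; nlinarith
  linarith

theorem abs_add_minGrowth_le_of_mul_pos (hm : 0 < m) (hx : m ≤ |x|) (hy : m ≤ |y|)
    (h : 0 < x * y * z) : |z| + minGrowth m r ≤ |x * y + z| := by
  have h1 : |x * y + z| = |x * y| + |z| :=
    (abs_add_eq_add_abs_iff _ _).2 (by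
      rcases le_total 0 z with hz | hz
      · exact .inl ⟨by nlinarith, hz⟩
      · exact .inr ⟨by nlinarith, hz⟩)
  have h2 : minGrowth m r ≤ m ^ 2 := min_le_left _ _
  have h3 : m ^ 2 ≤ |x * y| := by rw [abs_mul]; nlinarith
  linarith

/-- At a vertex the moves of the two imaginary traces cannot both descend, because `z ^ 2 > 4`. -/
theorem abs_add_minGrowth_le_of_abs_le (hr : 2 < r) (hm : 0 < m) (hx : m ≤ |x|) (hz : r ≤ |z|)
    (h : |x * z - y| ≤ |y|) : |x| + minGrowth m r ≤ |y * z - x| := by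
  have h1 : |x| * |z| ≤ 2 * |y| := by
    have := abs_sub_abs_le_abs_sub (x * z) y
    rw [abs_mul] at this
    linarith
  have h2 : |y| * |z| - |x| ≤ |y * z - x| := by
    have := abs_sub_abs_le_abs_sub (y * z) x
    rwa [abs_mul] at this
  have h3 : minGrowth m r ≤ (r ^ 2 / 2 - 2) * m := (min_le_right _ _).trans (min_le_right _ _)
  have h4 : (r ^ 2 / 2 - 2) * m ≤ (|z| ^ 2 / 2 - 2) * |x| := by
    have : r ^ 2 ≤ |z| ^ 2 := by gcongr
    have : 0 < r ^ 2 / 2 - 2 := by nlinarith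
    exact mul_le_mul (by linarith) hx hm.le (by linarith)
  have h5 : |x| * |z| * |z| ≤ 2 * |y| * |z| := by gcongr
  nlinarith

theorem mul_mul_ne_zero_of_le_abs (hr : 2 < r) (hm : 0 < m) (hx : m ≤ |x|) (hy : m ≤ |y|)
    (hz : r ≤ |z|) : x * y * z ≠ 0 :=
  mul_ne_zero (mul_ne_zero (abs_pos.1 (by linarith)) (abs_pos.1 (by linarith)))
    (abs_pos.1 (by linarith))

/-- At a vertex the moves of the real trace and of an imaginary one cannot both descend. -/
theorem abs_add_minGrowth_le_of_real_descends (hr : 2 < r) (hm : 0 < m) (hx : m ≤ |x|)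
    (hy : m ≤ |y|) (hz : r ≤ |z|) (h : |x * y + z| ≤ |z|) :
    |y| + minGrowth m r ≤ |x * z - y| := by
  rcases (mul_mul_ne_zero_of_le_abs hr hm hx hy hz).lt_or_gt with h' | h'
  · exact abs_add_minGrowth_le_of_mul_neg hr hm hx hz (by linarith)
  · have := abs_add_minGrowth_le_of_mul_pos (r := r) hm hx hy h'
    have := minGrowth_pos hm hr
    linarith

theorem abs_add_minGrowth_le_of_imaginary_descends (hr : 2 < r) (hm : 0 < m) (hx : m ≤ |x|)
    (hy : m ≤ |y|) (hz : r ≤ |z|) (h : |x * z - y| ≤ |y|) :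
    |z| + minGrowth m r ≤ |x * y + z| := by
  rcases (mul_mul_ne_zero_of_le_abs hr hm hx hy hz).lt_or_gt with h' | h'
  · have := abs_add_minGrowth_le_of_mul_neg (x := y) (y := x) hr hm hx hz (by linarith)
    have := minGrowth_pos hm hr
    linarith
  · exact abs_add_minGrowth_le_of_mul_pos hm hx hy h'

/-- The first two numbers are purely imaginary of absolute value at least `m`, and the third one
is real of absolute value at least `r`. -/
def IsImagImagReal (m r : ℝ) (ξ η ζ : ℂ) : Prop :=
  ∃ x y z : ℝ, ξ = Complex.I * x ∧ η = Complex.I * y ∧ ζ = z ∧ m ≤ |x| ∧ m ≤ |y| ∧ r ≤ |z|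

/-- One of the three numbers is real of absolute value at least `r`, and the other two are purely
imaginary of absolute value at least `m`. -/
def IsImagTriple (m r : ℝ) (ξ η ζ : ℂ) : Prop :=
  IsImagImagReal m r ξ η ζ ∨ IsImagImagReal m r η ζ ξ ∨ IsImagImagReal m r ξ ζ η

variable {ξ η ζ : ℂ}

theorem IsImagImagReal.swap (h : IsImagImagReal m r ξ η ζ) : IsImagImagReal m r η ξ ζ := by
  obtain ⟨x, y, z, hx, hy, hz, h1, h2, h3⟩ := h
  exact ⟨y, x, z, hy, hx, hz, h2, h1, h3⟩

theorem IsImagTriple.swap (h : IsImagTriple m r ξ η ζ) : IsImagTriple m r η ξ ζ := by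
  rcases h with h | h | h
  exacts [.inl h.swap, .inr (.inr h), .inr (.inl h)]

theorem norm_I_mul (x : ℝ) : ‖Complex.I * x‖ = |x| := by simp

theorem IsImagTriple.min_le_norm (h : IsImagTriple m r ξ η ζ) : min m r ≤ ‖ξ‖ := by
  rcases h with ⟨x, y, z, rfl, rfl, rfl, h1, h2, h3⟩ | ⟨x, y, z, rfl, rfl, rfl, h1, h2, h3⟩ |
    ⟨x, y, z, rfl, rfl, rfl, h1, h2, h3⟩
  · rw [norm_I_mul]; exact (min_le_left _ _).trans h1
  · rw [Complex.norm_real]; exact (min_le_right _ _).trans h3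
  · rw [norm_I_mul]; exact (min_le_left _ _).trans h1

theorem I_mul_notMem {x : ℝ} (hx : x ≠ 0) :
    Complex.I * (x : ℂ) ∉ (fun t : ℝ => (t : ℂ)) '' Set.Icc (-2) 2 := by
  rintro ⟨t, -, ht⟩
  have := congrArg Complex.im ht
  simp at this
  exact hx this.symm

theorem ofReal_notMem {z : ℝ} (hz : 2 < |z|) :
    (z : ℂ) ∉ (fun t : ℝ => (t : ℂ)) '' Set.Icc (-2) 2 := by
  rintro ⟨t, ht, hzt⟩
  obtain rfl : t = z := Complex.ofReal_injective hzt
  exact absurd (abs_le.2 ht) (not_le.2 hz)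

theorem IsImagTriple.notMem (hm : 0 < m) (hr : 2 < r) (h : IsImagTriple m r ξ η ζ) :
    ζ ∉ (fun t : ℝ => (t : ℂ)) '' Set.Icc (-2) 2 := by
  rcases h with ⟨x, y, z, rfl, rfl, rfl, h1, h2, h3⟩ | ⟨x, y, z, rfl, rfl, rfl, h1, h2, h3⟩ |
    ⟨x, y, z, rfl, rfl, rfl, h1, h2, h3⟩
  · exact ofReal_notMem (by linarith)
  · exact I_mul_notMem (abs_pos.1 (by linarith))
  · exact I_mul_notMem (abs_pos.1 (by linarith))

theorem imaginary_flip (x y z : ℝ) :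
    (z : ℂ) * (Complex.I * y) - Complex.I * x = Complex.I * ((y * z - x : ℝ) : ℂ) := by
  push_cast
  ring

theorem real_flip (x y z : ℝ) :
    Complex.I * x * (Complex.I * y) - z = ((-(x * y + z) : ℝ) : ℂ) := by
  push_cast
  linear_combination (x * y : ℂ) * Complex.I_sq

/-- If the move of `ζ` descends, then the move of `η` ascends. -/
theorem IsImagTriple.step (hm : 0 < m) (hr : 2 < r) (h : IsImagTriple m r ξ η ζ)
    (hζ : ‖ξ * η - ζ‖ ≤ ‖ζ‖) :
    ‖η‖ + minGrowth m r ≤ ‖ξ * ζ - η‖ ∧ IsImagTriple m r ξ ζ (ξ * ζ - η) := by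
  have hpos := minGrowth_pos hm hr
  rcases h with ⟨x, y, z, rfl, rfl, rfl, h1, h2, h3⟩ | ⟨x, y, z, rfl, rfl, rfl, h1, h2, h3⟩ |
    ⟨x, y, z, rfl, rfl, rfl, h1, h2, h3⟩
  · rw [real_flip, Complex.norm_real, Complex.norm_real, Real.norm_eq_abs, Real.norm_eq_abs,
      abs_neg] at hζ
    have key := abs_add_minGrowth_le_of_real_descends hr hm h1 h2 h3 hζ
    rw [mul_comm (Complex.I * (x : ℂ)), imaginary_flip, norm_I_mul, norm_I_mul]
    exact ⟨key, .inr (.inr ⟨x, x * z - y, z, rfl, rfl, rfl, h1, by linarith, h3⟩)⟩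
  · rw [imaginary_flip, norm_I_mul, norm_I_mul] at hζ
    have key := abs_add_minGrowth_le_of_abs_le hr hm h1 h3 hζ
    rw [imaginary_flip, norm_I_mul, norm_I_mul]
    exact ⟨key, .inr (.inl ⟨y, y * z - x, z, rfl, rfl, rfl, h2, by linarith, h3⟩)⟩
  · rw [mul_comm, imaginary_flip, norm_I_mul, norm_I_mul] at hζ
    have key := abs_add_minGrowth_le_of_imaginary_descends hr hm h1 h2 h3 hζ
    rw [real_flip, Complex.norm_real, Complex.norm_real, Real.norm_eq_abs, Real.norm_eq_abs,
      abs_neg]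
    exact ⟨key, .inl ⟨x, y, _, rfl, rfl, rfl, h1, h2, by rw [abs_neg]; linarith⟩⟩

/-- If the edge at the root of a Stern-Brocot tree leads away from a sink, then so do all edges of
the tree, and the sum of the three traces at a node grows linearly with the depth. -/
theorem SternBrocot.growth (hm : 0 < m) (hr : 2 < r) (ρ : F2 →* SL2C) {a b p q : F2} {n : ℕ}
    (h : SternBrocot a b n p q) (hab : IsImagTriple m r (tr ρ a) (tr ρ b) (tr ρ (a * b)))
    (hdesc : ‖tr ρ a * tr ρ b - tr ρ (a * b)‖ ≤ ‖tr ρ (a * b)‖) :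
    IsImagTriple m r (tr ρ p) (tr ρ q) (tr ρ (p * q)) ∧
      ‖tr ρ p * tr ρ q - tr ρ (p * q)‖ ≤ ‖tr ρ (p * q)‖ ∧
      n * minGrowth m r ≤ ‖tr ρ p‖ + ‖tr ρ q‖ + ‖tr ρ (p * q)‖ := by
  have hpos := minGrowth_pos hm hr
  induction h with
  | root => exact ⟨hab, hdesc, by simp; positivity⟩
  | @left n p q h ih =>
    obtain ⟨i1, i2, i3⟩ := ih
    obtain ⟨j1, j2⟩ := i1.step hm hr i2
    rw [tr_mul_mul_left]
    refine ⟨j2, ?_, ?_⟩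
    · rw [sub_sub_cancel]; linarith
    · push_cast; linarith
  | @right n p q h ih =>
    obtain ⟨i1, i2, i3⟩ := ih
    obtain ⟨j1, j2⟩ := i1.swap.step hm hr (by rwa [mul_comm])
    rw [tr_mul_mul_right]
    refine ⟨j2.swap, ?_, ?_⟩
    · rw [mul_comm, sub_sub_cancel]; linarith
    · push_cast; linarith

theorem SternBrocot.exists_depth_le (hm : 0 < m) (hr : 2 < r) (ρ : F2 →* SL2C) {a b : F2}
    (hab : IsImagTriple m r (tr ρ a) (tr ρ b) (tr ρ (a * b)))
    (hdesc : ‖tr ρ a * tr ρ b - tr ρ (a * b)‖ ≤ ‖tr ρ (a * b)‖) :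
    ∃ N : ℕ, ∀ n g, IsSternBrocotMul a b n g → ‖tr ρ g‖ ≤ 2 → n ≤ N := by
  have hpos := minGrowth_pos hm hr
  have hμ : 0 < min m r := lt_min hm (by linarith)
  obtain ⟨N, hN⟩ := exists_nat_ge ((8 / min m r + 2) / minGrowth m r)
  refine ⟨N, ?_⟩
  rintro n _ ⟨p, q, h, rfl⟩ hsmall
  obtain ⟨h1, h2, h3⟩ := h.growth hm hr ρ hab hdesc
  have hp := h1.min_le_norm
  have hq := h1.swap.min_le_norm
  -- `tr p * tr q = tr (p * q) + tr (p⁻¹ * q)`, and the first summand is the larger one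
  have hprod : ‖tr ρ p‖ * ‖tr ρ q‖ ≤ 4 := by
    rw [← norm_mul]
    have := norm_sub_norm_le (tr ρ p * tr ρ q) (tr ρ (p * q))
    linarith
  have hp' : ‖tr ρ p‖ ≤ 4 / min m r := by
    rw [le_div_iff₀ hμ]
    exact (mul_le_mul_of_nonneg_left hq (norm_nonneg _)).trans hprod
  have hq' : ‖tr ρ q‖ ≤ 4 / min m r := by
    rw [le_div_iff₀ hμ, mul_comm]
    exact (mul_le_mul_of_nonneg_right hp (norm_nonneg _)).trans hprod
  have h8 : 8 / min m r = 4 / min m r + 4 / min m r := by ring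
  have : (n : ℝ) ≤ N := by
    refine le_trans ?_ hN
    rw [le_div_iff₀ hpos]
    linarith
  exact_mod_cast this

theorem tr_conjInv (ρ : F2 →* SL2C) {g h : F2} (e : ConjInv g h) : tr ρ g = tr ρ h := by
  rcases e with e | e
  · exact tr_conj ρ e
  · exact (tr_conj ρ e).trans (tr_inv ρ h)

/-- An irreducible representation whose Markoff map has a sink satisfies the Bowditch
conditions. -/
theorem isBowditch_of_sink {ρ : F2 →* SL2C} (hρ : IsIrreducible ρ) {a b : F2}
    (hab : NielsenEquiv (a, b) (genX, genY)) (ha : tr ρ a = Complex.I * x)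
    (hb : tr ρ b = Complex.I * y) (hc : tr ρ (a * b) = z) (hx : x ≠ 0) (hy : y ≠ 0)
    (hz : 2 < |z|) (h1 : |x| ≤ |y * z - x|) (h2 : |y| ≤ |x * z - y|) (h3 : |z| ≤ |x * y + z|) :
    IsBowditch ρ := by
  set m := min |x| |y| with hm_def
  have hm : 0 < m := lt_min (abs_pos.2 hx) (abs_pos.2 hy)
  have hmx : m ≤ |x| := min_le_left _ _
  have hmy : m ≤ |y| := min_le_right _ _
  have hc' : tr ρ (a⁻¹ * b) = ((-(x * y + z) : ℝ) : ℂ) := by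
    rw [← real_flip, ← ha, ← hb, ← hc, tr_mul ρ a b]
    ring
  have ha' : tr ρ (a * b * b) = Complex.I * ((y * z - x : ℝ) : ℂ) := by
    rw [tr_mul_mul_right, hb, hc, ha, ← imaginary_flip]; ring
  have hb' : tr ρ (a * (a * b)) = Complex.I * ((x * z - y : ℝ) : ℂ) := by
    rw [tr_mul_mul_left, hb, hc, ha, ← imaginary_flip]; ring
  have t0 : IsImagTriple m |z| (tr ρ a) (tr ρ b) (tr ρ (a * b)) :=
    .inl ⟨x, y, z, ha, hb, hc, hmx, hmy, le_rfl⟩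
  have t1 : IsImagTriple m |z| (tr ρ a⁻¹) (tr ρ b) (tr ρ (a⁻¹ * b)) :=
    .inl ⟨x, y, _, by rw [tr_inv, ha], hb, hc', hmx, hmy, by rw [abs_neg]; exact h3⟩
  have t2 : IsImagTriple m |z| (tr ρ a) (tr ρ (a * b)) (tr ρ (a * (a * b))) :=
    .inr (.inr ⟨x, _, z, ha, hb', hc, hmx, hmy.trans h2, le_rfl⟩)
  have t3 : IsImagTriple m |z| (tr ρ (a * b)) (tr ρ b) (tr ρ (a * b * b)) :=
    .inr (.inl ⟨y, _, z, hb, ha', hc, hmy, hmx.trans h1, le_rfl⟩)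
  have d1 : ‖tr ρ a⁻¹ * tr ρ b - tr ρ (a⁻¹ * b)‖ ≤ ‖tr ρ (a⁻¹ * b)‖ := by
    have : tr ρ a⁻¹ * tr ρ b - tr ρ (a⁻¹ * b) = tr ρ (a * b) := by rw [tr_inv, tr_mul ρ a b]
    rw [this, hc, hc', Complex.norm_real, Complex.norm_real, Real.norm_eq_abs, Real.norm_eq_abs,
      abs_neg]
    exact h3
  have d2 : ‖tr ρ a * tr ρ (a * b) - tr ρ (a * (a * b))‖ ≤ ‖tr ρ (a * (a * b))‖ := by
    have : tr ρ a * tr ρ (a * b) - tr ρ (a * (a * b)) = tr ρ b := by rw [tr_mul_mul_left]; ring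
    rw [this, hb, hb', norm_I_mul, norm_I_mul]
    exact h2
  have d3 : ‖tr ρ (a * b) * tr ρ b - tr ρ (a * b * b)‖ ≤ ‖tr ρ (a * b * b)‖ := by
    have : tr ρ (a * b) * tr ρ b - tr ρ (a * b * b) = tr ρ a := by rw [tr_mul_mul_right]; ring
    rw [this, ha, ha', norm_I_mul, norm_I_mul]
    exact h1
  obtain ⟨N1, hN1⟩ := SternBrocot.exists_depth_le hm hz ρ t1 d1
  obtain ⟨N2, hN2⟩ := SternBrocot.exists_depth_le hm hz ρ t2 d2
  obtain ⟨N3, hN3⟩ := SternBrocot.exists_depth_le hm hz ρ t3 d3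
  refine ⟨hρ, ?_, ?_⟩
  · intro ω
    induction ω using Quotient.inductionOn with
    | h u =>
    show tr ρ u.1 ∉ _
    obtain ⟨g, hug, hg⟩ := u.2.exists_conjInv hab
    rw [tr_conjInv ρ hug]
    rcases hg with rfl | rfl | rfl | ⟨n, ⟨p, q, h, rfl⟩ | ⟨p, q, h, rfl⟩ | ⟨p, q, h, rfl⟩⟩
    · rw [ha]; exact I_mul_notMem hx
    · rw [hb]; exact I_mul_notMem hy
    · exact t0.notMem hm hz
    · exact (h.growth hm hz ρ t1 d1).1.notMem hm hz
    · exact (h.growth hm hz ρ t2 d2).1.notMem hm hz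
    · exact (h.growth hm hz ρ t3 d3).1.notMem hm hz
  · have hfin := ((Set.toFinite {a, b, a * b}).union (finite_isSternBrocotMul a⁻¹ b N1)).union
      ((finite_isSternBrocotMul a (a * b) N2).union (finite_isSternBrocotMul (a * b) b N3))
    -- an element determines at most one region
    refine (hfin.biUnion (t := fun g => {ω : Region | ∃ u : Prim, ω = Quotient.mk _ u ∧
      ConjInv u.1 g}) fun g _ => Set.Subsingleton.finite ?_).subset ?_
    · rintro _ ⟨u, rfl, hu⟩ _ ⟨v, rfl, hv⟩
      exact Quotient.sound (hu.trans hv.symm)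
    · intro ω hω
      induction ω using Quotient.inductionOn with
      | h u =>
      obtain ⟨g, hug, hg⟩ := u.2.exists_conjInv hab
      have hsmall : ‖tr ρ g‖ ≤ 2 := by rw [← tr_conjInv ρ hug]; exact hω
      refine Set.mem_biUnion (x := g) ?_ ⟨u, rfl, hug⟩
      rcases hg with h | h | h | ⟨n, h | h | h⟩
      · exact .inl (.inl (.inl h))
      · exact .inl (.inl (.inr (.inl h)))
      · exact .inl (.inl (.inr (.inr h)))
      · exact .inl (.inr ⟨n, hN1 n g h hsmall, h⟩)
      · exact .inr (.inl ⟨n, hN2 n g h hsmall, h⟩)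
      · exact .inr (.inr ⟨n, hN3 n g h hsmall, h⟩)

end Growth

/-! ### Representations with a given character -/

theorem exists_tr_eq (ξ η ζ : ℂ) :
    ∃ ρ : F2 →* SL2C, tr ρ genX = ξ ∧ tr ρ genY = η ∧ tr ρ (genX * genY) = ζ := by
  obtain ⟨d, hd⟩ := IsAlgClosed.exists_pow_nat_eq (ζ ^ 2 - 4) (n := 2) (by norm_num)
  -- `s` and `s⁻¹` are the eigenvalues of the product
  set s := (ζ + d) / 2 with hs
  set s' := (ζ - d) / 2 with hs'
  have hss : s * s' = 1 := by rw [hs, hs']; linear_combination -hd / 4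
  let A : SL2C := ⟨!![ξ, -1; 1, 0], by simp [Matrix.det_fin_two]⟩
  let B : SL2C := ⟨!![0, s; -s', η], by simp [Matrix.det_fin_two, hss]⟩
  refine ⟨FreeGroup.lift ![A, B], ?_, ?_, ?_⟩
  · simp [tr, genX, A]
  · simp [tr, genY, B]
  · have hAB : FreeGroup.lift ![A, B] (genX * genY) = A * B := by simp [genX, genY]
    rw [tr, hAB, Matrix.SpecialLinearGroup.coe_mul]
    simp only [A, B, Matrix.trace_fin_two, Matrix.mul_apply, Fin.sum_univ_two]
    simp only [Matrix.of_apply, Matrix.cons_val_zero, Matrix.cons_val_one, Matrix.cons_val']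
    rw [hs, hs']
    ring

theorem tr_one (ρ : F2 →* SL2C) : tr ρ 1 = 2 := by
  simp [tr]

theorem tr_commutator (ρ : F2 →* SL2C) (x y : F2) :
    tr ρ (x * y * x⁻¹ * y⁻¹) =
      tr ρ x ^ 2 + tr ρ y ^ 2 + tr ρ (x * y) ^ 2 - tr ρ x * tr ρ y * tr ρ (x * y) - 2 := by
  have e1 : tr ρ (x * y * x⁻¹ * y⁻¹) = tr ρ y * tr ρ y - tr ρ (x * (y⁻¹ * x⁻¹ * y⁻¹)) := by
    rw [tr_mul, tr_inv ρ y, tr_conj ρ (isConj_iff.2 ⟨x⁻¹, by group⟩ : IsConj (x * y * x⁻¹) y)]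
    congr 2
    group
  have e2 : tr ρ (y⁻¹ * x⁻¹ * y⁻¹) = tr ρ y * tr ρ (x * y) - tr ρ x := by
    rw [← tr_mul_mul_right, ← tr_inv ρ (x * y * y)]
    exact tr_conj ρ (isConj_iff.2 ⟨y⁻¹, by group⟩)
  have e3 : tr ρ (x⁻¹ * (y⁻¹ * x⁻¹ * y⁻¹)) = tr ρ (x * y) ^ 2 - 2 := by
    have : tr ρ (x⁻¹ * (y⁻¹ * x⁻¹ * y⁻¹)) = tr ρ (x * y * (x * y)) := by
      rw [← tr_inv ρ (x * y * (x * y))]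
      exact tr_conj ρ (isConj_iff.2 ⟨y⁻¹, by group⟩)
    rw [this, tr_mul, inv_mul_cancel, tr_one]
    ring
  rw [e1, tr_mul ρ x, e2, e3]
  ring

theorem mulVec_inv {A : SL2C} {v : Fin 2 → ℂ} {c : ℂ} (hv : v ≠ 0)
    (h : (A : Matrix (Fin 2) (Fin 2) ℂ).mulVec v = c • v) :
    c ≠ 0 ∧ (A⁻¹ : SL2C).1.mulVec v = c⁻¹ • v := by
  have h1 : (A⁻¹ : SL2C).1.mulVec (A.1.mulVec v) = v := by
    rw [Matrix.mulVec_mulVec, ← Matrix.SpecialLinearGroup.coe_mul, inv_mul_cancel,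
      Matrix.SpecialLinearGroup.coe_one, Matrix.one_mulVec]
  rw [h, Matrix.mulVec_smul] at h1
  have hc : c ≠ 0 := by
    rintro rfl
    rw [zero_smul] at h1
    exact hv h1.symm
  refine ⟨hc, ?_⟩
  rw [← h1, smul_smul, h1, inv_mul_cancel₀ hc, one_smul]

/-- An invariant line consists of fixed vectors of all commutators, so that their traces are `2`. -/
theorem isIrreducible_of_kappa_ne {ρ : F2 →* SL2C} (h : kappa (character ρ) ≠ 2) :
    IsIrreducible ρ := by
  rintro ⟨v, hv, hinv⟩
  apply h
  have hκ : kappa (character ρ) = tr ρ (genX * genY * genX⁻¹ * genY⁻¹) := by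
    rw [tr_commutator]
    simp only [kappa, character, genZ, tr_inv]
  obtain ⟨a, ha⟩ := hinv genX
  obtain ⟨b, hb⟩ := hinv genY
  obtain ⟨ha0, ha'⟩ := mulVec_inv hv ha
  obtain ⟨hb0, hb'⟩ := mulVec_inv hv hb
  set C := ρ (genX * genY * genX⁻¹ * genY⁻¹) with hC
  have hfix : C.1.mulVec v = v := by
    have : C.1 = (ρ genX).1 * (ρ genY).1 * ((ρ genX)⁻¹).1 * ((ρ genY)⁻¹).1 := by
      rw [hC]
      simp only [map_mul, map_inv, Matrix.SpecialLinearGroup.coe_mul]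
    rw [this, ← Matrix.mulVec_mulVec, hb', Matrix.mulVec_smul, ← Matrix.mulVec_mulVec, ha',
      Matrix.mulVec_smul, ← Matrix.mulVec_mulVec, hb, Matrix.mulVec_smul, ha]
    simp only [smul_smul]
    rw [show b⁻¹ * (a⁻¹ * (b * a)) = 1 by field_simp, one_smul]
  have hdet : (C.1 - 1).det = 0 :=
    Matrix.exists_mulVec_eq_zero_iff.1 ⟨v, hv, by rw [Matrix.sub_mulVec, hfix, Matrix.one_mulVec,
      sub_self]⟩
  have hdetC : C.1.det = 1 := C.2
  rw [hκ]
  show Matrix.trace C.1 = 2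
  rw [Matrix.det_fin_two] at hdet hdetC
  rw [Matrix.trace_fin_two]
  simp only [Matrix.sub_apply, Matrix.one_apply_eq] at hdet
  rw [Matrix.one_apply_ne (by decide), Matrix.one_apply_ne (by decide)] at hdet
  linear_combination hdetC - hdet

/-! ### The level surface over the plane of imaginary traces -/

/-- The positive root `z` of `z² + x y z = x² + y² + k + 2`. -/
noncomputable def posRoot (k : ℝ) (q : ℝ × ℝ) : ℝ :=
  (-(q.1 * q.2) + √((q.1 * q.2) ^ 2 + 4 * (q.1 ^ 2 + q.2 ^ 2 + k + 2))) / 2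

section PosRoot

variable {k : ℝ}

theorem posRoot_eq (hk : 2 < k) (q : ℝ × ℝ) :
    posRoot k q ^ 2 + q.1 * q.2 * posRoot k q = q.1 ^ 2 + q.2 ^ 2 + k + 2 := by
  have h : 0 ≤ (q.1 * q.2) ^ 2 + 4 * (q.1 ^ 2 + q.2 ^ 2 + k + 2) := by positivity
  have := Real.sq_sqrt h
  unfold posRoot
  linear_combination this / 4

theorem posRoot_pos (hk : 2 < k) (q : ℝ × ℝ) : 0 < posRoot k q := by
  have h : |q.1 * q.2| < √((q.1 * q.2) ^ 2 + 4 * (q.1 ^ 2 + q.2 ^ 2 + k + 2)) := by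
    rw [← Real.sqrt_sq_eq_abs]
    exact Real.sqrt_lt_sqrt (sq_nonneg _) (by nlinarith [sq_nonneg q.1, sq_nonneg q.2])
  have := le_abs_self (q.1 * q.2)
  unfold posRoot
  linarith

theorem eq_posRoot (hk : 2 < k) {q : ℝ × ℝ} {z : ℝ} (hz : 0 < z)
    (h : z ^ 2 + q.1 * q.2 * z = q.1 ^ 2 + q.2 ^ 2 + k + 2) : posRoot k q = z := by
  have h1 := posRoot_eq hk q
  have h2 := posRoot_pos hk q
  have h3 : (posRoot k q - z) * (posRoot k q + z + q.1 * q.2) = 0 := by linear_combination h1 - h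
  rcases mul_eq_zero.1 h3 with h4 | h4
  · linarith
  · -- the two roots would have a negative product
    have : posRoot k q * z = -(q.1 ^ 2 + q.2 ^ 2 + k + 2) := by
      linear_combination posRoot k q * h4 - h1
    have := mul_pos h2 hz
    nlinarith [sq_nonneg q.1, sq_nonneg q.2]

/-- The real trace stays away from `2`, locally uniformly. -/
theorem le_posRoot_sub_two_mul (hk : 2 < k) (q : ℝ × ℝ) :
    k - 2 ≤ (posRoot k q - 2) * (posRoot k q + 2 + |q.1| * |q.2|) := by
  have h1 := posRoot_eq hk q
  have h2 := posRoot_pos hk q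
  have h3 : q.1 * q.2 * posRoot k q ≤ |q.1| * |q.2| * posRoot k q := by
    rw [← abs_mul]
    gcongr
    exact le_abs_self _
  nlinarith [sq_nonneg (|q.1| - |q.2|), sq_abs q.1, sq_abs q.2]

theorem two_lt_posRoot (hk : 2 < k) (q : ℝ × ℝ) : 2 < posRoot k q := by
  have h1 := le_posRoot_sub_two_mul hk q
  have h2 := posRoot_pos hk q
  have h3 : 0 < posRoot k q + 2 + |q.1| * |q.2| := by positivity
  by_contra! h
  nlinarith

theorem posRoot_add_mul_pos (hk : 2 < k) (q : ℝ × ℝ) : 0 < q.1 * q.2 + posRoot k q := by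
  have h1 := posRoot_eq hk q
  have h2 := posRoot_pos hk q
  by_contra! h
  nlinarith [sq_nonneg q.1, sq_nonneg q.2]

variable (k) in
/-- The move of the first imaginary trace. -/
noncomputable def moveX (q : ℝ × ℝ) : ℝ × ℝ := (q.2 * posRoot k q - q.1, q.2)

variable (k) in
/-- The move of the second imaginary trace. -/
noncomputable def moveY (q : ℝ × ℝ) : ℝ × ℝ := (q.1, q.1 * posRoot k q - q.2)

/-- The move of the real trace. It makes the real trace negative, and the sign change of the
second and third traces makes it positive again. -/
def moveZ (q : ℝ × ℝ) : ℝ × ℝ := (q.1, -q.2)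

theorem posRoot_moveX (hk : 2 < k) (q : ℝ × ℝ) : posRoot k (moveX k q) = posRoot k q :=
  eq_posRoot hk (posRoot_pos hk q) (by
    simp only [moveX]
    linear_combination posRoot_eq hk q)

theorem posRoot_moveY (hk : 2 < k) (q : ℝ × ℝ) : posRoot k (moveY k q) = posRoot k q :=
  eq_posRoot hk (posRoot_pos hk q) (by
    simp only [moveY]
    linear_combination posRoot_eq hk q)

theorem posRoot_moveZ (hk : 2 < k) (q : ℝ × ℝ) :
    posRoot k (moveZ q) = q.1 * q.2 + posRoot k q :=
  eq_posRoot hk (posRoot_add_mul_pos hk q) (by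
    simp only [moveZ]
    linear_combination posRoot_eq hk q)

theorem posRoot_neg (q : ℝ × ℝ) : posRoot k (-q) = posRoot k q := by
  simp [posRoot]

theorem posRoot_swap (q : ℝ × ℝ) : posRoot k q.swap = posRoot k q := by
  simp [posRoot, mul_comm, add_comm]

theorem moveX_moveX (hk : 2 < k) (q : ℝ × ℝ) : moveX k (moveX k q) = q := by
  have h := posRoot_moveX hk q
  rw [moveX, h]
  simp [moveX]

theorem moveY_moveY (hk : 2 < k) (q : ℝ × ℝ) : moveY k (moveY k q) = q := by
  have h := posRoot_moveY hk q
  rw [moveY, h]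
  simp [moveY]

theorem moveZ_moveZ (q : ℝ × ℝ) : moveZ (moveZ q) = q := by simp [moveZ]

variable (k) in
/-- A sink: no move decreases any trace. -/
def IsSink (q : ℝ × ℝ) : Prop :=
  0 < q.1 * q.2 ∧ 2 * |q.1| ≤ |q.2| * posRoot k q ∧ 2 * |q.2| ≤ |q.1| * posRoot k q

variable (k) in
/-- The points with a sink in their orbit under the three moves. -/
inductive HasSink : ℝ × ℝ → Prop
  | sink {q : ℝ × ℝ} (h : IsSink k q) : HasSink q
  | moveX {q : ℝ × ℝ} (h : HasSink (moveX k q)) : HasSink q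
  | moveY {q : ℝ × ℝ} (h : HasSink (moveY k q)) : HasSink q
  | moveZ {q : ℝ × ℝ} (h : HasSink (moveZ q)) : HasSink q

variable (k) in
/-- A representation realizes a point `(x, y)` if some Nielsen transform of the standard basis has
the traces `(i x, i y, posRoot (x, y))`, up to the signs of two of them. -/
def Realizes (ρ : F2 →* SL2C) (q : ℝ × ℝ) : Prop :=
  ∃ a b : F2, NielsenEquiv (a, b) (genX, genY) ∧ ∃ σ τ : ℝ, σ ^ 2 = 1 ∧ τ ^ 2 = 1 ∧
    tr ρ a = Complex.I * ((σ * q.1 : ℝ) : ℂ) ∧ tr ρ b = Complex.I * ((τ * q.2 : ℝ) : ℂ) ∧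
      tr ρ (a * b) = ((σ * τ * posRoot k q : ℝ) : ℂ)

theorem Realizes.moveX (hk : 2 < k) {ρ : F2 →* SL2C} {q : ℝ × ℝ} (h : Realizes k ρ q) :
    Realizes k ρ (moveX k q) := by
  obtain ⟨a, b, hab, σ, τ, hσ, hτ, ha, hb, hc⟩ := h
  refine ⟨a * b * b, b⁻¹, ?_, σ, τ, hσ, hτ, ?_, ?_, ?_⟩
  · refine NielsenEquiv.trans (NielsenEquiv.symm ?_) hab
    exact (NielsenEquiv.swap a b).trans ((NielsenEquiv.mul_right b a).trans
      ((NielsenEquiv.mul_right b (a * b)).trans ((NielsenEquiv.swap _ _).trans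
        (NielsenEquiv.inv_right _ _))))
  · rw [tr_mul_mul_right, ha, hb, hc]
    simp only [ImaginaryCharacters.moveX]
    have hτ' : (τ : ℂ) ^ 2 = 1 := by exact_mod_cast hτ
    push_cast
    linear_combination (Complex.I * σ * q.2 * posRoot k q) * hτ'
  · rw [tr_inv, hb]; rfl
  · rw [mul_inv_cancel_right, hc, posRoot_moveX hk]

theorem Realizes.moveY (hk : 2 < k) {ρ : F2 →* SL2C} {q : ℝ × ℝ} (h : Realizes k ρ q) :
    Realizes k ρ (moveY k q) := by
  obtain ⟨a, b, hab, σ, τ, hσ, hτ, ha, hb, hc⟩ := h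
  refine ⟨a⁻¹, a * (a * b), ?_, σ, τ, hσ, hτ, ?_, ?_, ?_⟩
  · refine NielsenEquiv.trans (NielsenEquiv.symm ?_) hab
    exact (NielsenEquiv.mul_left a b).trans ((NielsenEquiv.mul_left a (a * b)).trans
        (NielsenEquiv.inv_left _ _))
  · rw [tr_inv, ha]; rfl
  · rw [tr_mul_mul_left, ha, hb, hc]
    simp only [ImaginaryCharacters.moveY]
    have hσ' : (σ : ℂ) ^ 2 = 1 := by exact_mod_cast hσ
    push_cast
    linear_combination (Complex.I * τ * q.1 * posRoot k q) * hσ'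
  · rw [inv_mul_cancel_left, hc, posRoot_moveY hk]

theorem Realizes.moveZ (hk : 2 < k) {ρ : F2 →* SL2C} {q : ℝ × ℝ} (h : Realizes k ρ q) :
    Realizes k ρ (moveZ q) := by
  obtain ⟨a, b, hab, σ, τ, hσ, hτ, ha, hb, hc⟩ := h
  refine ⟨a⁻¹, b, (NielsenEquiv.inv_left a b).symm.trans hab, σ, -τ, hσ, by simpa using hτ,
    ?_, ?_, ?_⟩
  · rw [tr_inv, ha]; rfl
  · rw [hb]; simp [ImaginaryCharacters.moveZ]
  · have e : tr ρ (a⁻¹ * b) = tr ρ a * tr ρ b - tr ρ (a * b) := by rw [tr_mul ρ a b]; ring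
    rw [e, ha, hb, hc, real_flip, posRoot_moveZ hk]
    congr 1
    ring

theorem HasSink.isBowditch (hk : 2 < k) {ρ : F2 →* SL2C} (hρ : IsIrreducible ρ) {q : ℝ × ℝ}
    (h : HasSink k q) (hq : Realizes k ρ q) : IsBowditch ρ := by
  induction h with
  | moveX _ ih => exact ih (hq.moveX hk)
  | moveY _ ih => exact ih (hq.moveY hk)
  | moveZ _ ih => exact ih (hq.moveZ hk)
  | @sink q h =>
    obtain ⟨a, b, hab, σ, τ, hσ, hτ, ha, hb, hc⟩ := hq
    obtain ⟨h1, h2, h3⟩ := h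
    have hZ := two_lt_posRoot hk q
    set Z := posRoot k q
    have hσ1 : |σ| = 1 := (pow_eq_one_iff_of_nonneg (abs_nonneg σ) two_ne_zero).1
      (by rw [sq_abs, hσ])
    have hτ1 : |τ| = 1 := (pow_eq_one_iff_of_nonneg (abs_nonneg τ) two_ne_zero).1
      (by rw [sq_abs, hτ])
    have hσ0 : σ ≠ 0 := abs_pos.1 (by rw [hσ1]; norm_num)
    have hτ0 : τ ≠ 0 := abs_pos.1 (by rw [hτ1]; norm_num)
    have hZa : |Z| = Z := abs_of_pos (by linarith)
    have e1 : τ * q.2 * (σ * τ * Z) - σ * q.1 = σ * (q.2 * Z - q.1) := by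
      linear_combination (σ * q.2 * Z) * hτ
    have e2 : σ * q.1 * (σ * τ * Z) - τ * q.2 = τ * (q.1 * Z - q.2) := by
      linear_combination (τ * q.1 * Z) * hσ
    have e3 : σ * q.1 * (τ * q.2) + σ * τ * Z = σ * τ * (q.1 * q.2 + Z) := by ring
    refine isBowditch_of_sink hρ hab ha hb hc (mul_ne_zero hσ0 (left_ne_zero_of_mul h1.ne'))
      (mul_ne_zero hτ0 (right_ne_zero_of_mul h1.ne')) ?_ ?_ ?_ ?_
    · rw [abs_mul, abs_mul, hσ1, hτ1, hZa]; linarith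
    · rw [e1, abs_mul, abs_mul, hσ1]
      have := abs_sub_abs_le_abs_sub (q.2 * Z) q.1
      rw [abs_mul, hZa] at this
      linarith
    · rw [e2, abs_mul, abs_mul, hτ1]
      have := abs_sub_abs_le_abs_sub (q.1 * Z) q.2
      rw [abs_mul, hZa] at this
      linarith
    · rw [e3, abs_mul, abs_mul, abs_mul, abs_mul, hσ1, hτ1, hZa]
      have := le_abs_self (q.1 * q.2 + Z)
      linarith

end PosRoot

/-! ### Sinks near points with a vanishing imaginary trace -/

section Zero

variable {k : ℝ}

theorem HasSink.neg {q : ℝ × ℝ} (h : HasSink k q) : HasSink k (-q) := by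
  induction h with
  | sink h => exact .sink (by simpa [IsSink, posRoot_neg] using h)
  | @moveX q _ ih =>
    refine .moveX ?_
    convert ih using 1
    ext <;> simp [ImaginaryCharacters.moveX, posRoot_neg]
    ring
  | @moveY q _ ih =>
    refine .moveY ?_
    convert ih using 1
    ext <;> simp [ImaginaryCharacters.moveY, posRoot_neg]
    ring
  | @moveZ q _ ih =>
    refine .moveZ ?_
    convert ih using 1
    ext <;> simp [ImaginaryCharacters.moveZ]

theorem HasSink.swap {q : ℝ × ℝ} (h : HasSink k q) : HasSink k q.swap := by
  induction h with
  | @sink q h =>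
    refine .sink ⟨?_, ?_, ?_⟩
    · rw [Prod.fst_swap, Prod.snd_swap, mul_comm]; exact h.1
    · rw [posRoot_swap]; exact h.2.2
    · rw [posRoot_swap]; exact h.2.1
  | @moveX q _ ih =>
    refine .moveY ?_
    convert ih using 1
    ext <;> simp [ImaginaryCharacters.moveX, ImaginaryCharacters.moveY, posRoot_swap]
  | @moveY q _ ih =>
    refine .moveX ?_
    convert ih using 1
    ext <;> simp [ImaginaryCharacters.moveX, ImaginaryCharacters.moveY, posRoot_swap]
  | @moveZ q _ ih =>
    refine .moveZ ?_
    convert ih.neg using 1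
    ext <;> simp [ImaginaryCharacters.moveZ]

variable (k) in
/-- The amplitude of the traces around a region with trace `2 i sinh t`. -/
noncomputable def amplitude (t : ℝ) : ℝ := √(k + 2 + 4 * Real.sinh t ^ 2) / Real.cosh t

theorem amplitude_sq (hk : 2 < k) (t : ℝ) :
    amplitude k t ^ 2 * Real.cosh t ^ 2 = k + 2 + 4 * Real.sinh t ^ 2 := by
  have h := Real.cosh_pos t
  rw [amplitude, div_pow, Real.sq_sqrt (by positivity), div_mul_cancel₀ _ (by positivity)]

theorem amplitude_pos (hk : 2 < k) (t : ℝ) : 0 < amplitude k t := by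
  have h := Real.cosh_pos t
  unfold amplitude
  positivity

theorem continuous_amplitude : Continuous (amplitude k) := by
  unfold amplitude
  exact (by fun_prop : Continuous fun t : ℝ => √(k + 2 + 4 * Real.sinh t ^ 2)).div
    Real.continuous_cosh fun t => (Real.cosh_pos t).ne'

variable (k) in
/-- The points with first coordinate `2 sinh t`, in a parametrization for which the moves around
this region are translations of `s`. -/
noncomputable def hyperbolicPoint (t s : ℝ) : ℝ × ℝ :=
  (2 * Real.sinh t, amplitude k t * Real.sinh s)

theorem posRoot_hyperbolicPoint (hk : 2 < k) (t s : ℝ) :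
    posRoot k (hyperbolicPoint k t s) = amplitude k t * Real.cosh (s - t) := by
  refine eq_posRoot hk (mul_pos (amplitude_pos hk t) (Real.cosh_pos _)) ?_
  have h := amplitude_sq hk t
  have h1 := Real.cosh_sq t
  have h2 := Real.cosh_sq s
  rw [Real.cosh_sub]
  simp only [hyperbolicPoint]
  set C := amplitude k t
  linear_combination h + C ^ 2 * Real.sinh s ^ 2 * h1 + C ^ 2 * Real.cosh t ^ 2 * h2

theorem moveY_moveZ_hyperbolicPoint (hk : 2 < k) (t s : ℝ) :
    moveY k (moveZ (hyperbolicPoint k t s)) = hyperbolicPoint k t (s + 2 * t) := by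
  have h1 := Real.cosh_sq t
  rw [moveY, posRoot_moveZ hk, posRoot_hyperbolicPoint hk]
  simp only [moveZ, hyperbolicPoint, Prod.mk.injEq, true_and]
  rw [Real.sinh_add, Real.sinh_two_mul, Real.cosh_two_mul, Real.cosh_sub]
  linear_combination (-amplitude k t * Real.sinh s) * h1

theorem isSink_hyperbolicPoint (hk : 2 < k) {t : ℝ} (ht : t ≠ 0) :
    IsSink k (hyperbolicPoint k t t) := by
  have hC := amplitude_pos hk t
  have hs : Real.sinh t ≠ 0 := by rwa [Ne, Real.sinh_eq_zero]
  have hs2 : 0 < Real.sinh t ^ 2 := by positivity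
  have hC2 : 2 ≤ amplitude k t := by
    have h := amplitude_sq hk t
    have h1 := Real.cosh_sq t
    by_contra! hlt
    have : amplitude k t ^ 2 < 4 := by nlinarith
    nlinarith [mul_lt_mul_of_pos_right this (show 0 < Real.cosh t ^ 2 by nlinarith)]
  refine ⟨?_, ?_, ?_⟩
  · simp only [hyperbolicPoint]; nlinarith [mul_pos hC hs2]
  all_goals
    rw [posRoot_hyperbolicPoint hk, sub_self, Real.cosh_zero]
    simp only [hyperbolicPoint, abs_mul, abs_of_pos hC, abs_two]
    have := abs_nonneg (Real.sinh t)
  · nlinarith [mul_le_mul hC2 hC2 (by norm_num) hC.le]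
  · nlinarith

theorem hasSink_hyperbolicPoint (hk : 2 < k) {t : ℝ} (ht : t ≠ 0) (n : ℕ) :
    HasSink k (hyperbolicPoint k t (t - 2 * n * t)) := by
  induction n with
  | zero => simpa using HasSink.sink (isSink_hyperbolicPoint hk ht)
  | succ n ih =>
    refine .moveZ (.moveY ?_)
    rw [moveY_moveZ_hyperbolicPoint hk]
    convert ih using 2
    push_cast
    ring

open Filter Topology in
/-- Near a point with vanishing first coordinate, the moves around its region are slow rotations
that bring points arbitrarily close to it to a sink. -/
theorem exists_hasSink_of_fst_eq_zero (hk : 2 < k) {V : Set (ℝ × ℝ)} (hV : IsOpen V) {q : ℝ × ℝ}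
    (hq : q ∈ V) (hq1 : q.1 = 0) : ∃ p ∈ V, HasSink k p := by
  have hopen : IsOpen {y : ℝ | ((0 : ℝ), y) ∈ V} := hV.preimage (by fun_prop)
  have hne : {y : ℝ | ((0 : ℝ), y) ∈ V}.Nonempty := ⟨q.2, by rw [← hq1] at *; exact hq⟩
  obtain ⟨y, hy0, hyV⟩ := (dense_compl_singleton (0 : ℝ)).exists_mem_open hopen hne
  have hy0 : y ≠ 0 := hy0
  set s := Real.arsinh (y / √(k + 2)) with hs
  have hk2 : 0 < √(k + 2) := Real.sqrt_pos.2 (by linarith)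
  have hs0 : s ≠ 0 := by
    rw [hs, Ne, Real.arsinh_eq_zero_iff]
    exact div_ne_zero hy0 hk2.ne'
  have ht : Tendsto (fun n : ℕ => -s / (2 * n + 1)) atTop (𝓝 0) := by
    refine Tendsto.div_atTop tendsto_const_nhds ?_
    exact tendsto_atTop_add_const_right _ _
      (tendsto_natCast_atTop_atTop.const_mul_atTop (by norm_num))
  have hcont : Continuous fun t => hyperbolicPoint k t s := by
    unfold hyperbolicPoint
    have := continuous_amplitude (k := k)
    fun_prop
  have hlim : hyperbolicPoint k 0 s = (0, y) := by
    have hy : √(k + 2) * (y / √(k + 2)) = y := by field_simp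
    simp [hyperbolicPoint, amplitude, hs, Real.sinh_arsinh, hy]
  have htend : Tendsto (fun n : ℕ => hyperbolicPoint k (-s / (2 * n + 1)) s) atTop
      (𝓝 (0, y)) := by
    rw [← hlim]
    exact (hcont.tendsto 0).comp ht
  obtain ⟨n, hn⟩ := (htend.eventually (hV.mem_nhds hyV)).exists
  refine ⟨_, hn, ?_⟩
  have hpos : (2 * n + 1 : ℝ) ≠ 0 := by positivity
  have := hasSink_hyperbolicPoint hk (t := -s / (2 * n + 1))
    (div_ne_zero (neg_ne_zero.2 hs0) hpos) (n + 1)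
  convert this using 2
  push_cast
  field_simp
  ring

theorem exists_hasSink_of_mul_eq_zero (hk : 2 < k) {V : Set (ℝ × ℝ)} (hV : IsOpen V) {q : ℝ × ℝ}
    (hq : q ∈ V) (hq0 : q.1 * q.2 = 0) : ∃ p ∈ V, HasSink k p := by
  rcases mul_eq_zero.1 hq0 with h | h
  · exact exists_hasSink_of_fst_eq_zero hk hV hq h
  · obtain ⟨p, hp, hps⟩ := exists_hasSink_of_fst_eq_zero hk (hV.preimage continuous_swap)
      (q := q.swap) (by simpa using hq) h
    exact ⟨p.swap, hp, hps.swap⟩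

end Zero

/-! ### Descent at points without a sink -/

section Descent

variable {k : ℝ}

variable (k) in
/-- The three moves. -/
noncomputable def move : Fin 3 → ℝ × ℝ → ℝ × ℝ := ![moveX k, moveY k, moveZ]

variable (k) in
/-- The region of the plane in which a given move descends. -/
def descentRegion : Fin 3 → Set (ℝ × ℝ) :=
  ![{q | 0 < q.1 * q.2 ∧ |q.2| * posRoot k q < 2 * |q.1|},
    {q | 0 < q.1 * q.2 ∧ |q.1| * posRoot k q < 2 * |q.2|},
    {q | q.1 * q.2 < 0}]

theorem continuous_posRoot : Continuous (posRoot k) := by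
  unfold posRoot
  fun_prop

theorem continuous_move (i : Fin 3) : Continuous (move k i) := by
  have := continuous_posRoot (k := k)
  fin_cases i
  · show Continuous (moveX k)
    unfold moveX
    fun_prop
  · show Continuous (moveY k)
    unfold moveY
    fun_prop
  · show Continuous moveZ
    unfold moveZ
    fun_prop

theorem move_move (hk : 2 < k) (i : Fin 3) (q : ℝ × ℝ) : move k i (move k i q) = q := by
  fin_cases i
  exacts [moveX_moveX hk q, moveY_moveY hk q, moveZ_moveZ q]

theorem HasSink.of_move {i : Fin 3} {q : ℝ × ℝ} (h : HasSink k (move k i q)) : HasSink k q := by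
  fin_cases i
  exacts [.moveX h, .moveY h, .moveZ h]

theorem isOpen_image_move (hk : 2 < k) (i : Fin 3) {W : Set (ℝ × ℝ)} (hW : IsOpen W) :
    IsOpen (move k i '' W) := by
  rw [Set.image_eq_preimage_of_inverse (move_move hk i) (move_move hk i)]
  exact hW.preimage (continuous_move i)

theorem isOpen_descentRegion (i : Fin 3) : IsOpen (descentRegion k i) := by
  have := continuous_posRoot (k := k)
  fin_cases i
  · show IsOpen ({q : ℝ × ℝ | 0 < q.1 * q.2} ∩ {q | |q.2| * posRoot k q < 2 * |q.1|})
    exact (isOpen_lt (by fun_prop) (by fun_prop)).inter (isOpen_lt (by fun_prop) (by fun_prop))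
  · show IsOpen ({q : ℝ × ℝ | 0 < q.1 * q.2} ∩ {q | |q.1| * posRoot k q < 2 * |q.2|})
    exact (isOpen_lt (by fun_prop) (by fun_prop)).inter (isOpen_lt (by fun_prop) (by fun_prop))
  · exact isOpen_lt (by fun_prop) (by fun_prop)

/-- On a connected open set without sinks in its orbit, the same move descends everywhere. -/
theorem exists_subset_descentRegion (hk : 2 < k) {W : Set (ℝ × ℝ)} (hW : IsOpen W)
    (hconn : IsPreconnected W) (hsink : ∀ q ∈ W, ¬ HasSink k q) :
    ∃ i, W ⊆ descentRegion k i := by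
  have hcover : W ⊆ (descentRegion k 0 ∪ descentRegion k 1) ∪ descentRegion k 2 := by
    intro q hq
    have h0 : q.1 * q.2 ≠ 0 := fun h => by
      obtain ⟨p, hp, hps⟩ := exists_hasSink_of_mul_eq_zero hk hW hq h
      exact hsink p hp hps
    rcases h0.lt_or_gt with h | h
    · exact .inr h
    · by_cases h1 : |q.2| * posRoot k q < 2 * |q.1|
      · exact .inl (.inl ⟨h, h1⟩)
      · by_cases h2 : |q.1| * posRoot k q < 2 * |q.2|
        · exact .inl (.inr ⟨h, h2⟩)
        · exact absurd (.sink ⟨h, not_lt.1 h1, not_lt.1 h2⟩) (hsink q hq)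
  have hd1 : Disjoint (descentRegion k 0 ∪ descentRegion k 1) (descentRegion k 2) := by
    rw [Set.disjoint_left]
    rintro q (⟨h, -⟩ | ⟨h, -⟩) (h' : q.1 * q.2 < 0) <;> exact lt_asymm h h'
  have hd2 : Disjoint (descentRegion k 0) (descentRegion k 1) := by
    rw [Set.disjoint_left]
    rintro q ⟨-, h1⟩ ⟨-, h2⟩
    have := two_lt_posRoot hk q
    have := abs_nonneg q.1
    have := abs_nonneg q.2
    nlinarith
  rcases hconn.subset_or_subset ((isOpen_descentRegion 0).union (isOpen_descentRegion 1))
    (isOpen_descentRegion 2) hd1 hcover with h | h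
  · rcases hconn.subset_or_subset (isOpen_descentRegion 0) (isOpen_descentRegion 1) hd2 h with
      h | h
    exacts [⟨0, h⟩, ⟨1, h⟩]
  · exact ⟨2, h⟩

/-- On a connected open set without sinks in its orbit, all points descend forever, and along the
same sequence of moves. -/
theorem exists_descent (hk : 2 < k) {V : Set (ℝ × ℝ)} (hV : IsOpen V)
    (hconn : IsPreconnected V) (hsink : ∀ q ∈ V, ¬ HasSink k q) :
    ∃ (s : ℕ → Fin 3) (φ : ℕ → ℝ × ℝ → ℝ × ℝ), φ 0 = id ∧
      (∀ n, φ (n + 1) = move k (s n) ∘ φ n) ∧ ∀ n, ∀ q ∈ V, φ n q ∈ descentRegion k (s n) := by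
  let Good : Set (ℝ × ℝ) → Prop := fun W =>
    IsOpen W ∧ IsPreconnected W ∧ ∀ q ∈ W, ¬ HasSink k q
  have step : ∀ W, ∃ i, Good W → W ⊆ descentRegion k i := by
    intro W
    by_cases hW : Good W
    · obtain ⟨i, hi⟩ := exists_subset_descentRegion hk hW.1 hW.2.1 hW.2.2
      exact ⟨i, fun _ => hi⟩
    · exact ⟨0, fun h => absurd h hW⟩
  choose i hi using step
  have hgood : ∀ W, Good W → Good (move k (i W) '' W) := by
    rintro W ⟨h1, h2, h3⟩
    refine ⟨isOpen_image_move hk _ h1, h2.image _ (continuous_move _).continuousOn, ?_⟩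
    rintro _ ⟨q, hq, rfl⟩ h
    exact h3 q hq h.of_move
  let W : ℕ → Set (ℝ × ℝ) := fun n => Nat.rec V (fun _ W => move k (i W) '' W) n
  let φ : ℕ → ℝ × ℝ → ℝ × ℝ := fun n => Nat.rec id (fun n f => move k (i (W n)) ∘ f) n
  have hW : ∀ n, Good (W n) := by
    intro n
    induction n with
    | zero => exact ⟨hV, hconn, hsink⟩
    | succ n ih => exact hgood _ ih
  have hφ : ∀ n, ∀ q ∈ V, φ n q ∈ W n := by
    intro n
    induction n with
    | zero => exact fun q hq => hq
    | succ n ih => exact fun q hq => ⟨φ n q, ih q hq, rfl⟩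
  exact ⟨fun n => i (W n), φ, rfl, fun _ => rfl, fun n q hq => hi _ (hW n) (hφ n q hq)⟩

theorem descend_X (hk : 2 < k) {q : ℝ × ℝ} (h : q ∈ descentRegion k 0) :
    |(moveX k q).1| = |(|q.2| * posRoot k q - |q.1|)| ∧ |(moveX k q).1| < |q.1| := by
  obtain ⟨h1, h2⟩ := h
  have hZ := posRoot_pos hk q
  set Z := posRoot k q
  have e : |(moveX k q).1| = |(|q.2| * Z - |q.1|)| := by
    show |q.2 * Z - q.1| = _
    rcases pos_and_pos_or_neg_and_neg_of_mul_pos h1 with ⟨hx, hy⟩ | ⟨hx, hy⟩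
    · rw [abs_of_pos hx, abs_of_pos hy]
    · rw [abs_of_neg hx, abs_of_neg hy, ← abs_neg]
      congr 1
      ring
  refine ⟨e, ?_⟩
  rw [e, abs_lt]
  have hy : 0 < |q.2| := abs_pos.2 (right_ne_zero_of_mul h1.ne')
  have := mul_pos hy hZ
  constructor <;> linarith

theorem descend_Y (hk : 2 < k) {q : ℝ × ℝ} (h : q ∈ descentRegion k 1) :
    |(moveY k q).2| = |(|q.1| * posRoot k q - |q.2|)| ∧ |(moveY k q).2| < |q.2| := by
  obtain ⟨h1, h2⟩ := h
  have h' : q.swap ∈ descentRegion k 0 :=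
    ⟨by rw [Prod.fst_swap, Prod.snd_swap, mul_comm]; exact h1, by rw [posRoot_swap]; exact h2⟩
  have := descend_X hk h'
  simpa [moveX, moveY, posRoot_swap] using this

theorem ne_zero_of_mem_descentRegion {i : Fin 3} {q : ℝ × ℝ} (h : q ∈ descentRegion k i) :
    q.1 ≠ 0 ∧ q.2 ≠ 0 := by
  have : q.1 * q.2 ≠ 0 := by
    fin_cases i
    exacts [h.1.ne', h.1.ne', ne_of_lt h]
  exact ⟨left_ne_zero_of_mul this, right_ne_zero_of_mul this⟩

theorem eq_zero_of_frequently {f : ℕ → ℝ} {a : ℝ} (hf : Filter.Tendsto f Filter.atTop (nhds a))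
    (h : ∃ᶠ n in Filter.atTop, f n = 0) : a = 0 :=
  isClosed_singleton.mem_of_frequently_of_tendsto (s := {(0 : ℝ)}) h hf

theorem frequently_of_tendsto_zero {f : ℕ → ℝ} (hf : Filter.Tendsto f Filter.atTop (nhds 0))
    (h0 : ∀ n, f n ≠ 0) {P : ℕ → Prop} (hP : ∀ n, ¬ P n → f (n + 1) = f n) :
    ∃ᶠ n in Filter.atTop, P n := by
  intro hcon
  obtain ⟨N, hN⟩ := Filter.eventually_atTop.1 hcon
  have hconst : ∀ n ≥ N, f n = f N := by
    intro n hn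
    induction n, hn using Nat.le_induction with
    | base => rfl
    | succ n hn ih => rw [hP n (hN n hn), ih]
  have : Filter.Tendsto f Filter.atTop (nhds (f N)) :=
    tendsto_const_nhds.congr' (Filter.eventually_atTop.2 ⟨N, fun n hn => (hconst n hn).symm⟩)
  exact h0 N (tendsto_nhds_unique this hf)

theorem exists_tendsto_of_nonneg {f : ℕ → ℝ} (h0 : ∀ n, 0 ≤ f n) (hf : ∀ n, f (n + 1) ≤ f n) :
    ∃ a, 0 ≤ a ∧ Filter.Tendsto f Filter.atTop (nhds a) := by
  have h := tendsto_atTop_ciInf (antitone_nat_of_succ_le hf)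
    ⟨0, by rintro _ ⟨n, rfl⟩; exact h0 n⟩
  exact ⟨_, ge_of_tendsto' h h0, h⟩

open Filter Topology in
/-- Along an infinite descent both imaginary traces tend to zero. -/
theorem tendsto_zero_of_descent (hk : 2 < k) {s : ℕ → Fin 3} {u : ℕ → ℝ × ℝ}
    (hu : ∀ n, u (n + 1) = move k (s n) (u n)) (hs : ∀ n, u n ∈ descentRegion k (s n)) :
    Tendsto u atTop (𝓝 0) := by
  have hZ2 := fun n => two_lt_posRoot hk (u n)
  have h0 : ∀ n, s n = 0 → u (n + 1) = moveX k (u n) ∧ u n ∈ descentRegion k 0 := fun n h => by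
    have h1 := hu n; have h2 := hs n; rw [h] at h1 h2; exact ⟨h1, h2⟩
  have h1 : ∀ n, s n = 1 → u (n + 1) = moveY k (u n) ∧ u n ∈ descentRegion k 1 := fun n h => by
    have h1 := hu n; have h2 := hs n; rw [h] at h1 h2; exact ⟨h1, h2⟩
  have h2 : ∀ n, s n = 2 → u (n + 1) = moveZ (u n) ∧ u n ∈ descentRegion k 2 := fun n h => by
    have h1 := hu n; have h2 := hs n; rw [h] at h1 h2; exact ⟨h1, h2⟩
  have cases3 : ∀ i : Fin 3, i = 0 ∨ i = 1 ∨ i = 2 := by decide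
  -- only the first move changes the first trace, and it shrinks it; likewise for the others
  have hx : ∀ n, s n ≠ 0 → |(u (n + 1)).1| = |(u n).1| := by
    intro n hn
    rcases cases3 (s n) with h | h | h
    · exact absurd h hn
    · rw [(h1 n h).1]; rfl
    · rw [(h2 n h).1]; rfl
  have hy : ∀ n, s n ≠ 1 → |(u (n + 1)).2| = |(u n).2| := by
    intro n hn
    rcases cases3 (s n) with h | h | h
    · rw [(h0 n h).1]; rfl
    · exact absurd h hn
    · rw [(h2 n h).1]; simp [moveZ]
  have hz : ∀ n, s n ≠ 2 → posRoot k (u (n + 1)) = posRoot k (u n) := by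
    intro n hn
    rcases cases3 (s n) with h | h | h
    · rw [(h0 n h).1, posRoot_moveX hk]
    · rw [(h1 n h).1, posRoot_moveY hk]
    · exact absurd h hn
  have hzX : ∀ n, s n = 2 →
      posRoot k (u (n + 1)) = posRoot k (u n) - |(u n).1| * |(u n).2| := by
    intro n hn
    obtain ⟨e, h⟩ := h2 n hn
    have h : (u n).1 * (u n).2 < 0 := h
    rw [e, posRoot_moveZ hk, ← abs_mul, abs_of_neg h]
    ring
  have hx' : ∀ n, |(u (n + 1)).1| ≤ |(u n).1| := by
    intro n
    by_cases h : s n = 0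
    · rw [(h0 n h).1]; exact (descend_X hk (h0 n h).2).2.le
    · exact (hx n h).le
  have hy' : ∀ n, |(u (n + 1)).2| ≤ |(u n).2| := by
    intro n
    by_cases h : s n = 1
    · rw [(h1 n h).1]; exact (descend_Y hk (h1 n h).2).2.le
    · exact (hy n h).le
  have hz' : ∀ n, posRoot k (u (n + 1)) ≤ posRoot k (u n) := by
    intro n
    by_cases h : s n = 2
    · have := mul_nonneg (abs_nonneg (u n).1) (abs_nonneg (u n).2)
      rw [hzX n h]; linarith
    · exact (hz n h).le
  -- a move does not descend twice in a row
  have hne : ∀ n, s (n + 1) ≠ s n := by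
    intro n hn
    rcases cases3 (s n) with h | h | h
    · rw [h] at hn
      have e1 := (descend_X hk (h0 n h).2).2
      have e2 := (descend_X hk (h0 (n + 1) hn).2).2
      rw [(h0 n h).1, moveX_moveX hk] at e2
      exact lt_asymm e1 e2
    · rw [h] at hn
      have e1 := (descend_Y hk (h1 n h).2).2
      have e2 := (descend_Y hk (h1 (n + 1) hn).2).2
      rw [(h1 n h).1, moveY_moveY hk] at e2
      exact lt_asymm e1 e2
    · rw [h] at hn
      have e1 : (u n).1 * (u n).2 < 0 := (h2 n h).2
      have e2 : (u (n + 1)).1 * (u (n + 1)).2 < 0 := (h2 (n + 1) hn).2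
      rw [(h2 n h).1] at e2
      simp only [moveZ, mul_neg] at e2
      linarith
  obtain ⟨α, hα0, hα⟩ := exists_tendsto_of_nonneg (fun n => abs_nonneg (u n).1) hx'
  obtain ⟨β, hβ0, hβ⟩ := exists_tendsto_of_nonneg (fun n => abs_nonneg (u n).2) hy'
  obtain ⟨γ, -, hγ⟩ := exists_tendsto_of_nonneg (fun n => (by linarith [hZ2 n] :
    0 ≤ posRoot k (u n))) hz'
  have hγ2 : 2 < γ := by
    have e1 : 2 ≤ γ := ge_of_tendsto' hγ fun n => (hZ2 n).le
    have e2 : k - 2 ≤ (γ - 2) * (γ + 2 + α * β) :=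
      ge_of_tendsto' ((hγ.sub_const 2).mul ((hγ.add_const 2).add (hα.mul hβ)))
        fun n => le_posRoot_sub_two_mul hk (u n)
    rcases e1.eq_or_lt with rfl | h
    · linarith
    · exact h
  -- the limits satisfy the equation of every move that occurs infinitely often
  have fX : (∃ᶠ n in atTop, s n = 0) → α = |β * γ - α| := fun h => by
    have := eq_zero_of_frequently (((tendsto_add_atTop_iff_nat 1).2 hα).sub
      (((hβ.mul hγ).sub hα).abs)) (h.mono fun n hn => by
        rw [(h0 n hn).1, (descend_X hk (h0 n hn).2).1, sub_self])
    linarith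
  have fY : (∃ᶠ n in atTop, s n = 1) → β = |α * γ - β| := fun h => by
    have := eq_zero_of_frequently (((tendsto_add_atTop_iff_nat 1).2 hβ).sub
      (((hα.mul hγ).sub hβ).abs)) (h.mono fun n hn => by
        rw [(h1 n hn).1, (descend_Y hk (h1 n hn).2).1, sub_self])
    linarith
  have fZ : (∃ᶠ n in atTop, s n = 2) → α * β = 0 := fun h => by
    have := eq_zero_of_frequently ((((tendsto_add_atTop_iff_nat 1).2 hγ).sub hγ).add (hα.mul hβ))
      (h.mono fun n hn => by rw [hzX n hn]; ring)
    linarith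
  have gX : α = 0 → ∃ᶠ n in atTop, s n = 0 := fun h =>
    frequently_of_tendsto_zero (h ▸ hα)
      (fun n => abs_ne_zero.2 (ne_zero_of_mem_descentRegion (hs n)).1) hx
  have gY : β = 0 → ∃ᶠ n in atTop, s n = 1 := fun h =>
    frequently_of_tendsto_zero (h ▸ hβ)
      (fun n => abs_ne_zero.2 (ne_zero_of_mem_descentRegion (hs n)).2) hy
  have two_of_three : ∀ i j l : Fin 3, (∀ m : Fin 3, m = i ∨ m = j ∨ m = l) →
      ¬ (∃ᶠ n in atTop, s n = i) → ∃ᶠ n in atTop, s n = j := by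
    intro i j l hijl hi hj
    obtain ⟨N, hN⟩ := eventually_atTop.1 ((not_frequently.1 hi).and hj)
    have e : ∀ n ≥ N, s n = l := fun n hn => by
      rcases hijl (s n) with h | h | h
      exacts [absurd h (hN n hn).1, absurd h (hN n hn).2, h]
    exact hne N ((e (N + 1) (by omega)).trans (e N le_rfl).symm)
  have hαβ : α = 0 ∧ β = 0 := by
    by_cases hX : ∃ᶠ n in atTop, s n = 0
    · by_cases hY : ∃ᶠ n in atTop, s n = 1
      · have e1 := fX hX
        have e2 := fY hY
        have key : ∀ a b : ℝ, 0 ≤ a → 0 ≤ b → a = |b * γ - a| → b = 0 ∨ b * γ = 2 * a := by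
          intro a b ha hb h
          rcases abs_choice (b * γ - a) with h' | h' <;> rw [h'] at h
          · right; linarith
          · left
            have : b * γ = 0 := by linarith
            rcases mul_eq_zero.1 this with h | h <;> linarith
        rcases key α β hα0 hβ0 e1 with e1 | e1 <;> rcases key β α hβ0 hα0 e2 with e2 | e2
        · exact ⟨e2, e1⟩
        · refine ⟨?_, e1⟩
          rw [e1] at e2
          nlinarith
        · refine ⟨e2, ?_⟩
          rw [e2] at e1
          nlinarith
        · constructor <;> nlinarith
      · have hβ : β ≠ 0 := fun h => hY (gY h)
        have hα : α = 0 := (mul_eq_zero.1 (fZ (two_of_three 1 2 0 (by decide) hY))).resolve_right hβ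
        have := fX hX
        rw [hα, sub_zero, eq_comm, abs_eq_zero] at this
        rcases mul_eq_zero.1 this with h | h
        · exact absurd h hβ
        · linarith
    · have hα : α ≠ 0 := fun h => hX (gX h)
      have hβ : β = 0 := (mul_eq_zero.1 (fZ (two_of_three 0 2 1 (by decide) hX))).resolve_left hα
      have := fY (gY hβ)
      rw [hβ, sub_zero, eq_comm, abs_eq_zero] at this
      rcases mul_eq_zero.1 this with h | h
      · exact absurd h hα
      · linarith
  rw [hαβ.1] at hα
  rw [hαβ.2] at hβ
  have e1 : Tendsto (fun n => (u n).1) atTop (𝓝 0) := (tendsto_zero_iff_abs_tendsto_zero _).2 hα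
  have e2 : Tendsto (fun n => (u n).2) atTop (𝓝 0) := (tendsto_zero_iff_abs_tendsto_zero _).2 hβ
  exact e1.prodMk_nhds e2

end Descent

/-! ### The invariant area -/

section Area

open MeasureTheory

variable {k : ℝ}

variable (k) in
/-- The derivative of `kappaImaginary` with respect to the real trace. Its inverse is the density
of the invariant area form of the level surface. -/
noncomputable def areaWeight (q : ℝ × ℝ) : ℝ := 2 * posRoot k q + q.1 * q.2

theorem areaWeight_eq (q : ℝ × ℝ) :
    areaWeight k q = √((q.1 * q.2) ^ 2 + 4 * (q.1 ^ 2 + q.2 ^ 2 + k + 2)) := by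
  unfold areaWeight posRoot
  ring

theorem one_le_areaWeight (hk : 2 < k) (q : ℝ × ℝ) : 1 ≤ areaWeight k q := by
  rw [areaWeight_eq, Real.one_le_sqrt]
  nlinarith [sq_nonneg (q.1 * q.2), sq_nonneg q.1, sq_nonneg q.2]

theorem continuous_areaWeight : Continuous (areaWeight k) := by
  have := continuous_posRoot (k := k)
  unfold areaWeight
  fun_prop

theorem differentiableAt_posRoot (hk : 2 < k) (q : ℝ × ℝ) : DifferentiableAt ℝ (posRoot k) q := by
  have h : (q.1 * q.2) ^ 2 + 4 * (q.1 ^ 2 + q.2 ^ 2 + k + 2) ≠ 0 := by positivity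
  have h1 : DifferentiableAt ℝ (fun q : ℝ × ℝ =>
      √((q.1 * q.2) ^ 2 + 4 * (q.1 ^ 2 + q.2 ^ 2 + k + 2))) q :=
    DifferentiableAt.sqrt (by fun_prop) h
  have h2 : DifferentiableAt ℝ (fun q : ℝ × ℝ => -(q.1 * q.2)) q := by fun_prop
  have h3 : posRoot k = fun q => (-(q.1 * q.2) +
      √((q.1 * q.2) ^ 2 + 4 * (q.1 ^ 2 + q.2 ^ 2 + k + 2))) * 2⁻¹ := funext fun q => by
    rw [posRoot, div_eq_mul_inv]
  rw [h3]
  exact (h2.fun_add h1).mul_const (2 : ℝ)⁻¹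

/-- Implicit differentiation of the equation of the level surface. -/
theorem areaWeight_mul_fderiv (hk : 2 < k) (q v : ℝ × ℝ) :
    areaWeight k q * fderiv ℝ (posRoot k) q v =
      (2 * q.1 - q.2 * posRoot k q) * v.1 + (2 * q.2 - q.1 * posRoot k q) * v.2 := by
  have hZ := (differentiableAt_posRoot hk q).hasFDerivAt
  have h1 : HasFDerivAt (fun q : ℝ × ℝ => q.1) (ContinuousLinearMap.fst ℝ ℝ ℝ) q := hasFDerivAt_fst
  have h2 : HasFDerivAt (fun q : ℝ × ℝ => q.2) (ContinuousLinearMap.snd ℝ ℝ ℝ) q := hasFDerivAt_snd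
  have hl := (hZ.pow 2).add ((h1.mul h2).mul hZ)
  have hr := (((h1.pow 2).add (h2.pow 2)).add_const k).add_const 2
  have heq : ((fun q => posRoot k q ^ 2) + fun q : ℝ × ℝ => q.1 * q.2 * posRoot k q) =
      fun q : ℝ × ℝ => q.1 ^ 2 + q.2 ^ 2 + k + 2 := funext fun q => posRoot_eq hk q
  have := congrArg (fun L : ℝ × ℝ →L[ℝ] ℝ => L v) (hl.unique (heq ▸ hr))
  simp at this
  unfold areaWeight
  linear_combination this

theorem det_prod_snd (M : ℝ × ℝ →L[ℝ] ℝ) :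
    (M.prod (ContinuousLinearMap.snd ℝ ℝ ℝ)).det = M (1, 0) := by
  rw [ContinuousLinearMap.det, ← LinearMap.det_toMatrix (Module.Basis.finTwoProd ℝ),
    Matrix.det_fin_two]
  simp [LinearMap.toMatrix_apply]

theorem det_fst_prod (M : ℝ × ℝ →L[ℝ] ℝ) :
    ((ContinuousLinearMap.fst ℝ ℝ ℝ).prod M).det = M (0, 1) := by
  rw [ContinuousLinearMap.det, ← LinearMap.det_toMatrix (Module.Basis.finTwoProd ℝ),
    Matrix.det_fin_two]
  simp [LinearMap.toMatrix_apply]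

theorem exists_hasFDerivAt_move (hk : 2 < k) (i : Fin 3) (q : ℝ × ℝ) :
    ∃ f' : ℝ × ℝ →L[ℝ] ℝ × ℝ, HasFDerivAt (move k i) f' q ∧
      areaWeight k q * |f'.det| = areaWeight k (move k i q) := by
  have hZ := (differentiableAt_posRoot hk q).hasFDerivAt
  have h1 : HasFDerivAt (fun q : ℝ × ℝ => q.1) (ContinuousLinearMap.fst ℝ ℝ ℝ) q := hasFDerivAt_fst
  have h2 : HasFDerivAt (fun q : ℝ × ℝ => q.2) (ContinuousLinearMap.snd ℝ ℝ ℝ) q := hasFDerivAt_snd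
  have hpos : ∀ q, 0 < areaWeight k q := fun q => by linarith [one_le_areaWeight hk q]
  have habs : ∀ d : ℝ, areaWeight k q * d = -areaWeight k (move k i q) →
      areaWeight k q * |d| = areaWeight k (move k i q) := by
    intro d hd
    have := congrArg abs hd
    rwa [abs_mul, abs_neg, abs_of_pos (hpos q), abs_of_pos (hpos _)] at this
  have hD := areaWeight_mul_fderiv hk q
  fin_cases i
  · refine ⟨_, ((h2.mul hZ).sub h1).prodMk h2, habs _ ?_⟩
    rw [det_prod_snd]
    have e : areaWeight k (move k 0 q) = 2 * posRoot k q + (q.2 * posRoot k q - q.1) * q.2 := by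
      rw [areaWeight]
      exact congrArg (2 * · + (q.2 * posRoot k q - q.1) * q.2) (posRoot_moveX hk q)
    refine Eq.trans ?_ (congrArg Neg.neg e.symm)
    have := hD (1, 0)
    simp at this ⊢
    have hw : areaWeight k q = 2 * posRoot k q + q.1 * q.2 := rfl
    linear_combination q.2 * this - hw
  · refine ⟨_, h1.prodMk ((h1.mul hZ).sub h2), habs _ ?_⟩
    rw [det_fst_prod]
    have e : areaWeight k (move k 1 q) = 2 * posRoot k q + q.1 * (q.1 * posRoot k q - q.2) := by
      rw [areaWeight]
      exact congrArg (2 * · + q.1 * (q.1 * posRoot k q - q.2)) (posRoot_moveY hk q)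
    refine Eq.trans ?_ (congrArg Neg.neg e.symm)
    have := hD (0, 1)
    simp at this ⊢
    have hw : areaWeight k q = 2 * posRoot k q + q.1 * q.2 := rfl
    linear_combination q.1 * this - hw
  · refine ⟨_, h1.prodMk h2.neg, habs _ ?_⟩
    rw [det_fst_prod]
    have e : areaWeight k (move k 2 q) = 2 * (q.1 * q.2 + posRoot k q) + q.1 * (-q.2) := by
      rw [areaWeight]
      exact congrArg (2 * · + q.1 * (-q.2)) (posRoot_moveZ hk q)
    refine Eq.trans ?_ (congrArg Neg.neg e.symm)
    have hw : areaWeight k q = 2 * posRoot k q + q.1 * q.2 := rfl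
    simp
    linear_combination -hw

variable (k) in
/-- The area of the level surface that is invariant under the moves, in the coordinates given by
the imaginary traces. -/
noncomputable def area : Measure (ℝ × ℝ) :=
  volume.withDensity fun q => ENNReal.ofReal (areaWeight k q)⁻¹

theorem measurePreserving_move (hk : 2 < k) (i : Fin 3) :
    MeasurePreserving (move k i) (area k) (area k) := by
  have hpos : ∀ q, 0 < areaWeight k q := fun q => by linarith [one_le_areaWeight hk q]
  refine ⟨(continuous_move i).measurable, ?_⟩
  ext A hA
  rw [Measure.map_apply (continuous_move i).measurable hA,
    ← Set.image_eq_preimage_of_inverse (move_move hk i) (move_move hk i)]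
  have himage : MeasurableSet (move k i '' A) := by
    rw [Set.image_eq_preimage_of_inverse (move_move hk i) (move_move hk i)]
    exact (continuous_move i).measurable hA
  choose f' hf' hdet using exists_hasFDerivAt_move hk i
  rw [area, withDensity_apply _ himage, withDensity_apply _ hA,
    lintegral_image_eq_lintegral_abs_det_fderiv_mul volume hA
      (fun x _ => (hf' x).hasFDerivWithinAt)
      (Function.LeftInverse.injective (move_move hk i)).injOn]
  refine lintegral_congr fun q => ?_
  rw [← ENNReal.ofReal_mul (abs_nonneg _), ← hdet q]
  have h1 := (hpos q).ne'
  have h2 : |(f' q).det| ≠ 0 := by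
    intro h
    have := hdet q
    rw [h, mul_zero] at this
    exact (hpos _).ne this
  congr 1
  field_simp

theorem area_le_volume (hk : 2 < k) : area k ≤ volume := by
  calc area k ≤ volume.withDensity 1 := by
        refine withDensity_mono (Filter.Eventually.of_forall fun q => ?_)
        exact ENNReal.ofReal_le_one.2 (inv_le_one_of_one_le₀ (one_le_areaWeight hk q))
    _ = volume := withDensity_one

theorem area_pos_of_isOpen (hk : 2 < k) {V : Set (ℝ × ℝ)} (hV : IsOpen V) (hne : V.Nonempty) :
    area k V ≠ 0 := by
  have hac : volume ≪ area k := by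
    refine withDensity_absolutelyContinuous' ?_ (Filter.Eventually.of_forall fun q => ?_)
    · exact (continuous_areaWeight.inv₀ fun q => by
        linarith [one_le_areaWeight hk q]).measurable.ennreal_ofReal.aemeasurable
    · have := one_le_areaWeight hk q
      exact (ENNReal.ofReal_pos.2 (by positivity)).ne'
  exact fun h => (hV.measure_pos volume hne).ne' (hac h)

open Filter Topology in
/-- If measure preserving maps move all points of `V` towards `x`, then the measure of `V` is at
most that of any neighbourhood of `x`. -/
theorem measure_le_of_tendsto {X : Type*} [TopologicalSpace X] [MeasurableSpace X] {μ : Measure X}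
    {φ : ℕ → X → X} (hφ : ∀ n, MeasurePreserving (φ n) μ μ) {V B : Set X} {x : X}
    (hB : MeasurableSet B) (hBx : B ∈ 𝓝 x) (hV : ∀ q ∈ V, Tendsto (fun n => φ n q) atTop (𝓝 x)) :
    μ V ≤ μ B := by
  let S : ℕ → Set X := fun N => {q | ∀ n ≥ N, φ n q ∈ B}
  have hmono : Monotone S := fun N M hNM q hq n hn => hq n (hNM.trans hn)
  have hsub : V ⊆ ⋃ N, S N := fun q hq => by
    obtain ⟨N, hN⟩ := eventually_atTop.1 ((hV q hq).eventually hBx)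
    exact Set.mem_iUnion.2 ⟨N, hN⟩
  calc μ V ≤ μ (⋃ N, S N) := measure_mono hsub
    _ = ⨆ N, μ (S N) := hmono.measure_iUnion
    _ ≤ μ B := iSup_le fun N =>
        (measure_mono (show S N ⊆ φ N ⁻¹' B from fun q hq => hq N le_rfl)).trans
          ((hφ N).measure_preimage hB.nullMeasurableSet).le

open Filter Topology in
/-- Sinks are dense: the orbits of a nonempty open set without sinks would descend together to
the origin, against the invariance of the area. -/
theorem exists_hasSink (hk : 2 < k) {V : Set (ℝ × ℝ)} (hV : IsOpen V) (hne : V.Nonempty) :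
    ∃ q ∈ V, HasSink k q := by
  obtain ⟨p, hp⟩ := hne
  obtain ⟨r, hr, hball⟩ := Metric.isOpen_iff.1 hV p hp
  by_contra! hcon
  obtain ⟨s, φ, hφ0, hφ, hs⟩ := exists_descent hk Metric.isOpen_ball
    (convex_ball p r).isPreconnected fun q hq => hcon q (hball hq)
  have hpres : ∀ n, MeasurePreserving (φ n) (area k) (area k) := by
    intro n
    induction n with
    | zero => rw [hφ0]; exact .id _
    | succ n ih => rw [hφ]; exact (measurePreserving_move hk _).comp ih
  have hlim : ∀ q ∈ Metric.ball p r, Tendsto (fun n => φ n q) atTop (𝓝 0) := fun q hq =>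
    tendsto_zero_of_descent hk (s := s) (fun n => by rw [hφ n]; rfl) fun n => hs n q hq
  refine area_pos_of_isOpen hk (Metric.isOpen_ball (x := p)) ⟨p, Metric.mem_ball_self hr⟩ ?_
  have hle : ∀ n : ℕ, area k (Metric.ball p r) ≤
      ENNReal.ofReal (2 * (1 / (n + 1))) * ENNReal.ofReal (2 * (1 / (n + 1))) := by
    intro n
    have hn : (0 : ℝ) < 1 / (n + 1) := by positivity
    refine (measure_le_of_tendsto hpres measurableSet_ball (Metric.ball_mem_nhds 0 hn) hlim).trans
      ((area_le_volume hk _).trans ?_)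
    rw [← Prod.mk_zero_zero, ← ball_prod_same, Measure.volume_eq_prod, Measure.prod_prod,
      Real.volume_ball]
  have htend : Tendsto (fun n : ℕ => ENNReal.ofReal (2 * (1 / ((n : ℝ) + 1))) *
      ENNReal.ofReal (2 * (1 / ((n : ℝ) + 1)))) atTop (𝓝 0) := by
    have h1 : Tendsto (fun n : ℕ => ENNReal.ofReal (2 * (1 / ((n : ℝ) + 1)))) atTop (𝓝 0) := by
      have := (tendsto_one_div_add_atTop_nhds_zero_nat (𝕜 := ℝ)).const_mul 2
      rw [mul_zero] at this
      simpa using ENNReal.tendsto_ofReal this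
    have := ENNReal.Tendsto.mul h1 (.inr ENNReal.zero_ne_top) h1 (.inr ENNReal.zero_ne_top)
    rwa [mul_zero] at this
  exact nonpos_iff_eq_zero.1 (ge_of_tendsto' htend hle)

end Area

/-! ### Density of the Bowditch set in the level surface -/

/-- Both roots `z` of the equation of the level surface are realized by the point `(x, y)`: the
positive one by the standard basis, and the negative one by its image under the move of `Z`. -/
theorem imaginaryCharacter_mem_bowditchSet {k : ℝ} (hk : 2 < k) {p : ℝ × ℝ × ℝ}
    (hp : p ∈ levelSurface k) (h : HasSink k (p.1, p.2.1)) :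
    imaginaryCharacter p ∈ bowditchSet := by
  obtain ⟨ρ, hX, hY, hXY⟩ := exists_tr_eq (Complex.I * p.1) (Complex.I * p.2.1) p.2.2
  have hchar : character ρ = imaginaryCharacter p := by
    rw [character, genZ, tr_inv, hX, hY, hXY, imaginaryCharacter]
  have hp' : kappaImaginary p = k := hp
  refine ⟨ρ, hchar, h.isBowditch hk (isIrreducible_of_kappa_ne ?_) ?_⟩
  · rw [hchar, kappa_imaginaryCharacter, hp']
    intro h2
    have : k = 2 := by exact_mod_cast h2
    linarith
  have heq : p.2.2 ^ 2 + p.1 * p.2.1 * p.2.2 = p.1 ^ 2 + p.2.1 ^ 2 + k + 2 := by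
    rw [kappaImaginary] at hp'
    linarith
  rcases lt_or_ge 0 p.2.2 with hz | hz
  · have hroot : posRoot k (p.1, p.2.1) = p.2.2 := eq_posRoot hk hz heq
    refine ⟨genX, genY, .refl _, 1, 1, by norm_num, by norm_num, ?_, ?_, ?_⟩
    · simpa using hX
    · simpa using hY
    · rw [hroot]; simpa using hXY
  · have hroot : posRoot k (p.1, p.2.1) = -(p.1 * p.2.1 + p.2.2) := by
      refine eq_posRoot hk ?_ (by dsimp only; linear_combination heq)
      by_contra! hcon
      nlinarith [sq_nonneg p.1, sq_nonneg p.2.1]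
    refine ⟨genX⁻¹, genY, (NielsenEquiv.inv_left _ _).symm, 1, 1, by norm_num, by norm_num,
      ?_, ?_, ?_⟩
    · rw [tr_inv, hX, one_mul]
    · rw [hY, one_mul]
    · have e : tr ρ (genX⁻¹ * genY) = tr ρ genX * tr ρ genY - tr ρ (genX * genY) := by
        rw [tr_mul ρ genX genY]; ring
      rw [e, hX, hY, hXY, real_flip, hroot, one_mul, one_mul]

end ImaginaryCharacters

theorem mainTheorem4 (k : ℝ) (hk : 2 < k) :
    interior {p : ImaginaryCharacters.levelSurface k |
      ImaginaryCharacters.imaginaryCharacter p.1 ∉ ImaginaryCharacters.bowditchSet} = ∅ := by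
  open ImaginaryCharacters in
  rw [Set.eq_empty_iff_forall_notMem]
  intro p hp
  obtain ⟨U, hUsub, hU, hpU⟩ := mem_interior.1 hp
  have hpk : kappaImaginary p.1 = k := p.2
  rw [kappaImaginary] at hpk
  -- a continuous section through `p` of the projection to the imaginary traces
  obtain ⟨g, hg, hgp⟩ : ∃ g : ℝ × ℝ → levelSurface k, Continuous g ∧
      (∀ q, ((g q).1.1, (g q).1.2.1) = q) ∧ g (p.1.1, p.1.2.1) = p := by
    have hcont := continuous_posRoot (k := k)
    have hroot := fun q => posRoot_eq hk q
    rcases lt_or_ge 0 p.1.2.2 with hz | hz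
    · refine ⟨fun q => ⟨(q.1, q.2, posRoot k q), ?_⟩, ?_, fun q => rfl, ?_⟩
      · show kappaImaginary _ = k
        simp only [kappaImaginary]
        linear_combination hroot q
      · exact Continuous.subtype_mk (by fun_prop) _
      · refine Subtype.ext (Prod.ext rfl (Prod.ext rfl ?_))
        exact eq_posRoot hk hz (by dsimp only; linear_combination hpk)
    · refine ⟨fun q => ⟨(q.1, q.2, -(q.1 * q.2 + posRoot k q)), ?_⟩, ?_, fun q => rfl, ?_⟩
      · show kappaImaginary _ = k
        simp only [kappaImaginary]
        linear_combination hroot q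
      · exact Continuous.subtype_mk (by fun_prop) _
      · refine Subtype.ext (Prod.ext rfl (Prod.ext rfl ?_))
        have : posRoot k (p.1.1, p.1.2.1) = -(p.1.1 * p.1.2.1 + p.1.2.2) := by
          refine eq_posRoot hk ?_ (by dsimp only; linear_combination hpk)
          by_contra! hcon
          nlinarith [sq_nonneg p.1.1, sq_nonneg p.1.2.1]
        dsimp only
        rw [this]
        ring
  obtain ⟨q, hq, hsink⟩ := exists_hasSink hk (hU.preimage hg)
    ⟨(p.1.1, p.1.2.1), by rw [Set.mem_preimage, hgp.2]; exact hpU⟩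
  refine hUsub hq (imaginaryCharacter_mem_bowditchSet hk (g q).2 ?_)
  rw [hgp.1 q]
  exact hsink
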